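/- **Setting.** Let $G\subset\mathbb R^2$ be a bounded domain whose boundary is the disjoint union $\partial G=\Gamma_1\cup\Gamma_2\cup\{g,h\}$, where $\Gamma_1,\Gamma_2$ are open $C^\infty$ curves (simple arcs, regular and smooth up to their end points) and $g\neq h$ are the two end points of each of $\overline{\Gamma_1}$ and $\overline{\Gamma_2}$. Suppose that in a neighbourhood of each of the points $g,h$ the domain $G$ coincides with a plane angle of opening $\pi$ (a half-plane). For $i=1,2$ let $\Omega_i$ be a $C^\infty$-diffeomorphism of a neighbourhood of $\overline{\Gamma_i}$ onto an open set such that $\Omega_i(\Gamma_i)\subset G$, $\Omega_i(g)=g$, $\Omega_i(h)=h$, and, near each of the points $g$ and $h$, $\Omega_i$ acts on $\Gamma_i$ as the rotation about that point through the angle $\pi/2$ inwards $G$. Let $\Omega$ be a $C^\infty$-diffeomorphism of a neighbourhood of $\overline{\Gamma_1}$ onto an open set such that $\Omega(\Gamma_1)\subset G$ and $\overline{\Omega(\Gamma_1)}\cap\{g,h\}=\varnothing$. Let $b_1,b_2$ be real-valued $C^\infty$-functions on $\mathbb R^2$. For a real-valued $C^\infty$-function $a$ on $\mathbb R^2$ and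 $f_0\in L_2(G)$ consider the problem with homogeneous nonlocal conditions $$\Delta u=f_0\quad\text{in }G,$$ $$u(y)+b_1(y)\,u(\Omega_1(y))+a(y)\,u(\Omega(y))=0\quad(y\in\Gamma_1),$$ $$u(y)+b_2(y)\,u(\Omega_2(y))=0\quad(y\in\Gamma_2).$$ A function $u\in W^1(G)$ is a *generalized solution* if it satisfies the equation in the sense of distributions and the nonlocal conditions in the sense of traces. Here $W^k(G)=W^k_2(G)$ is the Sobolev space of functions whose weak derivatives of order at most $k$ lie in $L_2(G)$. **Theorem.** Suppose that $-2<b_1(g)+b_2(g)<0$ or $-2<b_1(h)+b_2(h)<0$. Then there exists a (real-valued) function $f_0\in L_2(G)$, which does not depend on $a$, such that for every real-valued coefficient $a\in C^\infty(\mathbb R^2)$ the above problem has a (real-valued) generalized solution $u\in W^1(G)$ with $u\notin W^2(G)$. -/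

import Mathlib

open MeasureTheory Set Filter Topology
open scoped ContDiff

/-- The Euclidean plane `ℝ²`. -/
abbrev Plane := EuclideanSpace ℝ (Fin 2)

noncomputable section

namespace NonlocalProblem

/-- The classical partial derivative `∂φ/∂y_j`, `j = 0, 1`. -/
def pd (j : Fin 2) (φ : Plane → ℝ) (y : Plane) : ℝ :=
  fderiv ℝ φ y (EuclideanSpace.single j 1)

/-- Test functions: `φ ∈ C₀^∞(G)`, i.e. smooth with compact support contained in `G`. -/
def IsTest (G : Set Plane) (φ : Plane → ℝ) : Prop :=
  ContDiff ℝ ∞ φ ∧ HasCompactSupport φ ∧ tsupport φ ⊆ G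

/-- `u ∈ L₂(G)`. -/
def InL2 (G : Set Plane) (u : Plane → ℝ) : Prop := MemLp u 2 (volume.restrict G)

/-- `v = ∂u/∂y_j` in the sense of distributions on `G`. -/
def HasWeakPartial (G : Set Plane) (j : Fin 2) (u v : Plane → ℝ) : Prop :=
  ∀ φ, IsTest G φ → ∫ y in G, u y * pd j φ y = - ∫ y in G, v y * φ y

/-- The Sobolev space `W^k(G) = W^k_2(G)`: `W^0(G) = L₂(G)`, and `u ∈ W^{k+1}(G)` when
`u ∈ L₂(G)` has both first order weak derivatives, and these belong to `W^k(G)`. -/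
def InSobolev (G : Set Plane) : ℕ → (Plane → ℝ) → Prop
  | 0, u => InL2 G u
  | k + 1, u => InL2 G u ∧ ∀ j, ∃ v, HasWeakPartial G j u v ∧ InSobolev G k v

/-- `Δu = f` in the sense of distributions on `G`. -/
def WeakPoisson (G : Set Plane) (u f : Plane → ℝ) : Prop :=
  ∀ φ, IsTest G φ → ∫ y in G, u y * Laplacian.laplacian φ y = ∫ y in G, f y * φ y

/-- The functions `φ n`, smooth on the plane, converge to `u` in the norm of `W^1(G)`. -/
def TendstoW1 (G : Set Plane) (φ : ℕ → Plane → ℝ) (u : Plane → ℝ) : Prop :=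
  Tendsto (fun n => eLpNorm (φ n - u) 2 (volume.restrict G)) atTop (𝓝 0) ∧
  ∀ j, ∃ v, InL2 G v ∧ HasWeakPartial G j u v ∧
    Tendsto (fun n => eLpNorm (pd j (φ n) - v) 2 (volume.restrict G)) atTop (𝓝 0)

/-- `v ∈ L₂(0,1)` is the trace of `u ∈ W^1(G)` along the parametrized arc `c : (0,1) → closure G`:
`v` is the `L₂`-limit of the restrictions `φ n ∘ c`, where the smooth functions `φ n` converge to
`u` in `W^1(G)`. -/
def HasTraceAlong (G : Set Plane) (u : Plane → ℝ) (c : ℝ → Plane) (v : ℝ → ℝ) : Prop :=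
  MemLp v 2 (volume.restrict (Ioo 0 1)) ∧
  ∃ φ : ℕ → Plane → ℝ, (∀ n, ContDiff ℝ ∞ (φ n)) ∧ TendstoW1 G φ u ∧
    Tendsto (fun n => eLpNorm (φ n ∘ c - v) 2 (volume.restrict (Ioo (0 : ℝ) 1))) atTop (𝓝 0)

/-- `γ` is a regular parametrization over `[0,1]` of a simple smooth arc from `g` to `h`. -/
structure IsSmoothArc (γ : ℝ → Plane) (g h : Plane) : Prop where
  smooth : ContDiff ℝ ∞ γ
  regular : ∀ t ∈ Icc (0 : ℝ) 1, deriv γ t ≠ 0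
  injOn : InjOn γ (Icc 0 1)
  start : γ 0 = g
  finish : γ 1 = h

/-- The open curve (the arc without its end points). -/
def openCurve (γ : ℝ → Plane) : Set Plane := γ '' Ioo 0 1

/-- In a neighbourhood of its boundary point `p`, the set `G` is a plane angle of opening `π`,
i.e. a half-plane (with interior unit normal `n`). -/
def IsFlatNear (G : Set Plane) (p : Plane) : Prop :=
  ∃ n : Plane, ‖n‖ = 1 ∧ ∀ᶠ y in 𝓝 p, (y ∈ G ↔ 0 < inner ℝ n (y - p))

/-- The bounded domain `G`, its boundary being the disjoint union of the open smooth curves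
`Γ₁`, `Γ₂` and of their common end points `g`, `h`, near which `G` is a half-plane. -/
structure IsDomain (G : Set Plane) (g h : Plane) (γ₁ γ₂ : ℝ → Plane) : Prop where
  isOpen : IsOpen G
  connected : IsConnected G
  bounded : Bornology.IsBounded G
  arc₁ : IsSmoothArc γ₁ g h
  arc₂ : IsSmoothArc γ₂ g h
  disjoint : Disjoint (openCurve γ₁) (openCurve γ₂)
  frontier_eq : frontier G = openCurve γ₁ ∪ openCurve γ₂ ∪ {g, h}
  flat_g : IsFlatNear G g
  flat_h : IsFlatNear G h

/-- `T` is a `C^∞`-diffeomorphism of some neighbourhood `O` of the set `S` onto the open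
set `T(O)`. -/
def IsDiffeoNear (T : Plane → Plane) (S : Set Plane) : Prop :=
  ∃ O : Set Plane, IsOpen O ∧ S ⊆ O ∧ IsOpen (T '' O) ∧ ContDiffOn ℝ ∞ T O ∧
    ∃ T' : Plane → Plane, ContDiffOn ℝ ∞ T' (T '' O) ∧ ∀ y ∈ O, T' (T y) = y

/-- Rotation of the plane about the origin through the angle `π/2` (counterclockwise). -/
def quarterTurn (y : Plane) : Plane := !₂[-(y 1), y 0]

/-- Near the point `p`, the map `T` rotates the curve `Γ` about `p` through the angle `π/2`,
clockwise or counterclockwise. -/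
def RotatesNear (T : Plane → Plane) (Γ : Set Plane) (p : Plane) : Prop :=
  T p = p ∧
  ((∀ᶠ y in 𝓝[Γ] p, T y = p + quarterTurn (y - p)) ∨
   (∀ᶠ y in 𝓝[Γ] p, T y = p - quarterTurn (y - p)))

/-- The transformation `Ω_i` attached to the curve `Γ_i`: a diffeomorphism near the closed curve,
mapping the open curve into `G`, and acting near the end points `g`, `h` on the curve as the
rotation through the angle `π/2`, necessarily inwards `G`. -/
structure IsNearTransformation (G : Set Plane) (g h : Plane) (γ : ℝ → Plane)
    (T : Plane → Plane) : Prop where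
  diffeo : IsDiffeoNear T (closure (openCurve γ))
  mapsTo : MapsTo T (openCurve γ) G
  rotates_g : RotatesNear T (openCurve γ) g
  rotates_h : RotatesNear T (openCurve γ) h

/-- The transformation `Ω`: a diffeomorphism near the closed curve, mapping the open curve into
`G`, with the closure of the image containing neither `g` nor `h`. -/
structure IsFarTransformation (G : Set Plane) (g h : Plane) (γ : ℝ → Plane)
    (T : Plane → Plane) : Prop where
  diffeo : IsDiffeoNear T (closure (openCurve γ))
  mapsTo : MapsTo T (openCurve γ) G
  away : closure (T '' openCurve γ) ∩ {g, h} = ∅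

/-- `u` is a generalized solution of the problem
`Δu = f₀` in `G`,
`u(y) + b₁(y) u(Ω₁(y)) + a(y) u(Ω(y)) = f₁(y)` on `Γ₁`,
`u(y) + b₂(y) u(Ω₂(y)) = f₂(y)` on `Γ₂`:
`u ∈ W^1(G)`, the equation holds in the sense of distributions and the nonlocal conditions hold
almost everywhere on the curves in the sense of traces. -/
structure IsGeneralizedSolution (G : Set Plane) (γ₁ γ₂ : ℝ → Plane) (Ω₁ Ω₂ Ω : Plane → Plane)
    (b₁ b₂ a f₀ f₁ f₂ u : Plane → ℝ) : Prop where
  inW1 : InSobolev G 1 u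
  equation : WeakPoisson G u f₀
  condition₁ : ∃ v w z : ℝ → ℝ, HasTraceAlong G u γ₁ v ∧ HasTraceAlong G u (Ω₁ ∘ γ₁) w ∧
    HasTraceAlong G u (Ω ∘ γ₁) z ∧
    ∀ᵐ t ∂(volume.restrict (Ioo (0 : ℝ) 1)),
      v t + b₁ (γ₁ t) * w t + a (γ₁ t) * z t = f₁ (γ₁ t)
  condition₂ : ∃ v w : ℝ → ℝ, HasTraceAlong G u γ₂ v ∧ HasTraceAlong G u (Ω₂ ∘ γ₂) w ∧
    ∀ᵐ t ∂(volume.restrict (Ioo (0 : ℝ) 1)), v t + b₂ (γ₂ t) * w t = f₂ (γ₂ t)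

end NonlocalProblem

end

/-! Everything happens at one end point p where b₁ + b₂ lies in (-2, 0). In isometric coordinates z
= r e^{iθ} about p, the domain is locally the half-plane |θ| < π/2, Γ₁ and Γ₂ lie on the rays θ =
π/2 and θ = -π/2, and both Ω₁ and Ω₂ carry a nearby boundary point to the point of the ray θ = 0 at
the same distance from p (`exists_local_coordinates`). With coefficients frozen at p, the harmonic
function r^μ (cos μθ + C sin μθ) satisfies the nonlocal conditions exactly when cos(πμ/2) + C
sin(πμ/2) = -b₁(p) and cos(πμ/2) - C sin(πμ/2) = -b₂(p). The sum of the two equations determines an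
exponent 0 < μ < 1 (`exists_exponent`), their difference determines C. The gradient is then of size
r^(μ-1), which is square integrable in the plane, while the second derivatives are of size r^(μ-2),
which is not.

For variable coefficients, C becomes a function of y, and a term D(y) · `imPower` with D(p) = 0 is
added, so that the conditions hold exactly along the curves. These corrections are smooth functions
vanishing at p times homogeneous functions of degree μ, hence of order μ + 1
(`hasOrder_remainderTerm`). Their Laplacian is O(r^(μ-1)), so f₀ := Δu is in L₂
(`inL2_laplacian_singularSolution`), and they are too small to cancel the blow-up of the second
derivatives (`not_inSobolev_two_of_homogeneous`).

Finally, everything is multiplied by a radial cutoff about p. Being radial, it takes equal values at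
y and Ω_i(y), so the conditions survive. Its support is so small that u vanishes on Ω(Γ₁); the term
with a is then zero, and the same u and f₀ serve every a. The traces of u are its restrictions,
because cutting out shrinking discs about p gives smooth approximations in W^1
(`HasOrder.hasTraceAlong`). -/

namespace NonlocalProblem

/-! ### Functions of power order at a point -/

/-- `u` is smooth off the point `p`, near which its derivatives of order `k` are
`O(|y - p|^(μ - k))`. -/
def HasOrder (p : Plane) (μ : ℝ) (u : Plane → ℝ) : Prop :=
  ContDiffOn ℝ ∞ u {p}ᶜ ∧ ∀ k : ℕ, ∃ K, 0 ≤ K ∧ ∀ y, y ≠ p → ‖y - p‖ ≤ 1 →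
    ‖iteratedFDeriv ℝ k u y‖ ≤ K * ‖y - p‖ ^ (μ - k)

theorem HasOrder.contDiffAt {p : Plane} {μ : ℝ} {u : Plane → ℝ} (h : HasOrder p μ u)
    {y : Plane} (hy : y ≠ p) : ContDiffAt ℝ ∞ u y :=
  h.1.contDiffAt (isOpen_compl_singleton.mem_nhds hy)

theorem norm_sub_pos_of_ne {p y : Plane} (hy : y ≠ p) : 0 < ‖y - p‖ :=
  norm_pos_iff.2 (sub_ne_zero.2 hy)

theorem HasOrder.mono {p : Plane} {μ ν : ℝ} {u : Plane → ℝ} (h : HasOrder p μ u) (hν : ν ≤ μ) :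
    HasOrder p ν u := by
  refine ⟨h.1, fun k => ?_⟩
  obtain ⟨K, hK, hb⟩ := h.2 k
  refine ⟨K, hK, fun y hy h1 => (hb y hy h1).trans ?_⟩
  exact mul_le_mul_of_nonneg_left
    (Real.rpow_le_rpow_of_exponent_ge (norm_sub_pos_of_ne hy) h1 (by linarith)) hK

theorem HasOrder.add {p : Plane} {μ : ℝ} {u v : Plane → ℝ} (hu : HasOrder p μ u)
    (hv : HasOrder p μ v) : HasOrder p μ (fun y => u y + v y) := by
  refine ⟨hu.1.add hv.1, fun k => ?_⟩
  obtain ⟨K, hK, hb⟩ := hu.2 k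
  obtain ⟨M, hM, hc⟩ := hv.2 k
  refine ⟨K + M, by positivity, fun y hy h1 => ?_⟩
  have e : iteratedFDeriv ℝ k (fun y => u y + v y) y
      = iteratedFDeriv ℝ k u y + iteratedFDeriv ℝ k v y :=
    iteratedFDeriv_add_apply ((hu.contDiffAt hy).of_le (by exact_mod_cast le_top))
      ((hv.contDiffAt hy).of_le (by exact_mod_cast le_top))
  rw [e, add_mul]
  exact (norm_add_le _ _).trans (add_le_add (hb y hy h1) (hc y hy h1))

/-- Leibniz formula: in every term the exponents μ - i and ν - (k - i) add up to μ + ν - k. -/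
theorem HasOrder.mul {p : Plane} {μ ν : ℝ} {u v : Plane → ℝ} (hu : HasOrder p μ u)
    (hv : HasOrder p ν v) : HasOrder p (μ + ν) (fun y => u y * v y) := by
  refine ⟨hu.1.mul hv.1, fun k => ?_⟩
  choose K hK hb using hu.2
  choose M hM hc using hv.2
  refine ⟨∑ i ∈ Finset.range (k + 1), (k.choose i : ℝ) * K i * M (k - i),
    Finset.sum_nonneg fun i _ => by have := hK i; have := hM (k - i); positivity,
    fun y hy h1 => ?_⟩
  have ho : IsOpen ({p}ᶜ : Set Plane) := isOpen_compl_singleton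
  have e := norm_iteratedFDerivWithin_mul_le (n := k) hu.1 hv.1 ho.uniqueDiffOn hy
    (by exact_mod_cast le_top)
  simp only [iteratedFDerivWithin_of_isOpen _ ho (show y ∈ ({p}ᶜ : Set Plane) from hy)] at e
  refine e.trans ?_
  rw [Finset.sum_mul]
  refine Finset.sum_le_sum fun i hi => ?_
  have hik : i ≤ k := Nat.lt_succ_iff.1 (Finset.mem_range.1 hi)
  have hr := norm_sub_pos_of_ne hy
  calc _ ≤ (k.choose i : ℝ) * (K i * ‖y - p‖ ^ (μ - i)) *
        (M (k - i) * ‖y - p‖ ^ (ν - (k - i : ℕ))) := by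
        have := hK i; have := hM (k - i)
        gcongr
        · exact hb i y hy h1
        · exact hc (k - i) y hy h1
    _ = (k.choose i : ℝ) * K i * M (k - i) *
        (‖y - p‖ ^ (μ - i) * ‖y - p‖ ^ (ν - (k - i : ℕ))) := by ring
    _ = _ := by
        rw [← Real.rpow_add hr]
        congr 2
        push_cast [hik]
        ring

theorem exists_bound_iteratedFDeriv {P : Plane → ℝ} (hP : ContDiff ℝ ∞ P) (p : Plane) (k : ℕ) :
    ∃ K, 0 ≤ K ∧ ∀ y, ‖y - p‖ ≤ 1 → ‖iteratedFDeriv ℝ k P y‖ ≤ K := by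
  have hc : Continuous (iteratedFDeriv ℝ k P) :=
    hP.continuous_iteratedFDeriv (by exact_mod_cast le_top)
  obtain ⟨K, hK⟩ := (isCompact_closedBall p 1).exists_bound_of_continuousOn hc.continuousOn
  refine ⟨K, (norm_nonneg _).trans (hK p (by simp)), fun y hy => hK y ?_⟩
  simpa [dist_eq_norm] using hy

/-- The value is O(r) by the mean value inequality; for k ≥ 1 bounded derivatives suffice, since
r^(1-k) ≥ 1 when r ≤ 1. This is the source of the extra order of the remainder term. -/
theorem HasOrder.of_contDiff_of_eq_zero {P : Plane → ℝ} (hP : ContDiff ℝ ∞ P) {p : Plane}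
    (h0 : P p = 0) : HasOrder p 1 P := by
  refine ⟨hP.contDiffOn, fun k => ?_⟩
  rcases Nat.eq_zero_or_pos k with rfl | hk
  · obtain ⟨K, hK, hb⟩ := exists_bound_iteratedFDeriv hP p 1
    refine ⟨K, hK, fun y hy h1 => ?_⟩
    have := (convex_closedBall p 1).norm_image_sub_le_of_norm_fderiv_le (𝕜 := ℝ) (f := P) (C := K)
      (x := p) (y := y)
      (fun x _ => hP.differentiable (by simp) x)
      (fun x hx => by
        rw [← norm_iteratedFDeriv_one]
        exact hb x (by simpa [dist_eq_norm] using hx)) (by simp)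
      (by simpa [dist_eq_norm] using h1)
    simpa [h0] using this
  · obtain ⟨K, hK, hb⟩ := exists_bound_iteratedFDeriv hP p k
    refine ⟨K, hK, fun y hy h1 => (hb y h1).trans (le_mul_of_one_le_right hK ?_)⟩
    refine Real.one_le_rpow_of_pos_of_le_one_of_nonpos (norm_sub_pos_of_ne hy) h1 ?_
    have : (1 : ℝ) ≤ k := by exact_mod_cast hk
    linarith

/-- The iterated derivatives of a homogeneous function are homogeneous. -/
theorem iteratedFDeriv_smul_of_homogeneous {F : Plane → ℝ} {μ : ℝ}
    (hF : ContDiffOn ℝ ∞ F {0}ᶜ) (hom : ∀ t : ℝ, 0 < t → ∀ x, F (t • x) = t ^ μ * F x)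
    (k : ℕ) {t : ℝ} (ht : 0 < t) {x : Plane} (hx : x ≠ 0) :
    iteratedFDeriv ℝ k F (t • x) = t ^ (μ - k) • iteratedFDeriv ℝ k F x := by
  have ho : IsOpen ({0}ᶜ : Set Plane) := isOpen_compl_singleton
  let g : Plane →L[ℝ] Plane := t • ContinuousLinearMap.id ℝ Plane
  have hpre : g ⁻¹' {0}ᶜ = {0}ᶜ := by
    ext z; simp [g, ht.ne']
  have hx' : g x ∈ ({0}ᶜ : Set Plane) := by simp [g, ht.ne', hx]
  have h1 := g.iteratedFDerivWithin_comp_right (i := k) hF ho.uniqueDiffOn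
    (by rw [hpre]; exact ho.uniqueDiffOn) hx' (by exact_mod_cast le_top)
  rw [hpre, iteratedFDerivWithin_of_isOpen _ ho hx', iteratedFDerivWithin_of_isOpen _ ho
    (show x ∈ ({0}ᶜ : Set Plane) from hx)] at h1
  have h2 : F ∘ g = fun z => t ^ μ • F z := by
    ext z; simp [g, hom t ht]
  rw [h2, iteratedFDeriv_const_smul_apply'
    ((hF.contDiffAt (ho.mem_nhds hx)).of_le (by exact_mod_cast le_top))] at h1
  have hgx : g x = t • x := rfl
  rw [hgx] at h1
  ext m
  have h3 := congrArg (fun T => T m) h1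
  simp only [ContinuousMultilinearMap.compContinuousLinearMap_apply,
    smul_apply] at h3
  have h4 : (fun i => g (m i)) = fun i => t • m i := rfl
  rw [h4, ContinuousMultilinearMap.map_smul_univ] at h3
  simp only [Finset.prod_const, Finset.card_univ, Fintype.card_fin, smul_eq_mul] at h3
  rw [smul_apply, smul_eq_mul, Real.rpow_sub ht, Real.rpow_natCast]
  field_simp
  linarith

/-- By homogeneity of the derivatives, the bound reduces to one on the compact unit sphere. -/
theorem HasOrder.of_homogeneous {F : Plane → ℝ} {μ : ℝ} (hF : ContDiffOn ℝ ∞ F {0}ᶜ)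
    (hom : ∀ t : ℝ, 0 < t → ∀ x, F (t • x) = t ^ μ * F x) (p : Plane) :
    HasOrder p μ (fun y => F (y - p)) := by
  have ho : IsOpen ({0}ᶜ : Set Plane) := isOpen_compl_singleton
  refine ⟨hF.comp (by fun_prop) fun y hy => sub_ne_zero.2 hy, fun k => ?_⟩
  have hc : ContinuousOn (iteratedFDeriv ℝ k F) (Metric.sphere 0 1) := by
    have := hF.continuousOn_iteratedFDerivWithin (m := k) (by exact_mod_cast le_top)
      ho.uniqueDiffOn
    refine (this.congr fun y hy => (iteratedFDerivWithin_of_isOpen _ ho hy).symm).mono ?_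
    intro y hy h0
    simp [mem_singleton_iff.1 h0] at hy
  obtain ⟨K, hK⟩ := (isCompact_sphere (0 : Plane) 1).exists_bound_of_continuousOn hc
  refine ⟨max K 0, le_max_right _ _, fun y hy h1 => ?_⟩
  have hr := norm_sub_pos_of_ne hy
  rw [iteratedFDeriv_comp_sub]
  set x := y - p with hx
  have e : x = ‖x‖ • (‖x‖⁻¹ • x) := by rw [smul_smul, mul_inv_cancel₀ hr.ne', one_smul]
  have hne : ‖x‖⁻¹ • x ≠ 0 := smul_ne_zero (inv_ne_zero hr.ne') (norm_pos_iff.1 hr)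
  rw [e, iteratedFDeriv_smul_of_homogeneous hF hom k hr hne, ← e, norm_smul, mul_comm,
    Real.norm_of_nonneg (Real.rpow_nonneg hr.le _)]
  gcongr
  refine (hK _ ?_).trans (le_max_left _ _)
  simp [norm_smul, hr.ne']

/-! ### Classical and weak derivatives -/

theorem integrable_mul_of_tsupport_subset {G : Set Plane} (hG : IsOpen G) {f φ : Plane → ℝ}
    (hf : ContinuousOn f G) (hφ : Continuous φ) (hc : HasCompactSupport φ) (hs : tsupport φ ⊆ G) :
    Integrable (fun y => f y * φ y) := by
  have hts : tsupport (fun y => f y * φ y) ⊆ tsupport φ := tsupport_mul_subset_right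
  refine Continuous.integrable_of_hasCompactSupport ?_ hc.mul_left
  exact continuous_of_tsupport fun y hy =>
    (hf.continuousAt (hG.mem_nhds (hs (hts hy)))).mul hφ.continuousAt

theorem setIntegral_mul_eq_integral {G : Set Plane} {f φ : Plane → ℝ} (hs : tsupport φ ⊆ G) :
    ∫ y in G, f y * φ y = ∫ y, f y * φ y :=
  setIntegral_eq_integral_of_forall_compl_eq_zero fun y hy => by
    rw [image_eq_zero_of_notMem_tsupport fun h => hy (hs h), mul_zero]

theorem tsupport_pd_subset (j : Fin 2) (φ : Plane → ℝ) : tsupport (pd j φ) ⊆ tsupport φ :=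
  tsupport_fderiv_apply_subset ℝ _

theorem IsTest.pd {G : Set Plane} {φ : Plane → ℝ} (h : IsTest G φ) (j : Fin 2) :
    IsTest G (pd j φ) := by
  refine ⟨?_, ?_, (tsupport_pd_subset j φ).trans h.2.2⟩
  · exact (h.1.fderiv_right (m := ∞) (by simp)).clm_apply contDiff_const
  · exact h.2.1.mono' ((subset_tsupport _).trans (tsupport_pd_subset j φ))

theorem contDiffOn_pd {G : Set Plane} (hG : IsOpen G) {u : Plane → ℝ} (hu : ContDiffOn ℝ ∞ u G)
    (j : Fin 2) : ContDiffOn ℝ ∞ (pd j u) G :=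
  (hu.fderiv_of_isOpen hG (m := ∞) (by simp)).clm_apply contDiffOn_const

/-- A classical derivative is a weak one. -/
theorem hasWeakPartial_of_contDiffOn {G : Set Plane} (hG : IsOpen G) {u : Plane → ℝ}
    (hu : ContDiffOn ℝ ∞ u G) (j : Fin 2) : HasWeakPartial G j u (pd j u) := by
  intro φ hφ
  have hφ' := hφ.pd j
  rw [setIntegral_mul_eq_integral hφ'.2.2, setIntegral_mul_eq_integral hφ.2.2]
  refine integral_mul_fderiv_eq_neg_fderiv_mul_of_integrable ?_ ?_ ?_ ?_ ?_
  · exact integrable_mul_of_tsupport_subset hG (contDiffOn_pd hG hu j).continuousOn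
      hφ.1.continuous hφ.2.1 hφ.2.2
  · exact integrable_mul_of_tsupport_subset hG hu.continuousOn
      hφ'.1.continuous hφ'.2.1 hφ'.2.2
  · exact integrable_mul_of_tsupport_subset hG hu.continuousOn
      hφ.1.continuous hφ.2.1 hφ.2.2
  · exact fun x hx => (hu.contDiffAt (hG.mem_nhds (hφ.2.2 hx))).differentiableAt (by simp)
  · exact fun x _ => hφ.1.differentiable (by simp) x

theorem pd_pd_eq {u : Plane → ℝ} {y : Plane} (hu : ContDiffAt ℝ ∞ u y) (j k : Fin 2) :
    pd k (pd j u) y = iteratedFDeriv ℝ 2 u y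
      ![EuclideanSpace.single k 1, EuclideanSpace.single j 1] := by
  have h : DifferentiableAt ℝ (fderiv ℝ u) y :=
    (hu.fderiv_right (m := 1) (by norm_cast)).differentiableAt (by simp)
  rw [iteratedFDeriv_two_apply]
  unfold pd
  rw [fderiv_clm_apply h (differentiableAt_const _)]
  simp

theorem laplacian_eq_sum_pd {u : Plane → ℝ} {y : Plane} (hu : ContDiffAt ℝ ∞ u y) :
    Laplacian.laplacian u y = pd 0 (pd 0 u) y + pd 1 (pd 1 u) y := by
  rw [pd_pd_eq hu, pd_pd_eq hu, InnerProductSpace.laplacian_eq_iteratedFDeriv_orthonormalBasis u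
    (EuclideanSpace.basisFun (Fin 2) ℝ)]
  simp

/-- The classical Laplacian is the distributional one. -/
theorem weakPoisson_of_contDiffOn {G : Set Plane} (hG : IsOpen G) {u : Plane → ℝ}
    (hu : ContDiffOn ℝ ∞ u G) : WeakPoisson G u (Laplacian.laplacian u) := by
  intro φ hφ
  have key : ∀ j, ∫ y in G, u y * pd j (pd j φ) y = ∫ y in G, pd j (pd j u) y * φ y := by
    intro j
    rw [hasWeakPartial_of_contDiffOn hG hu j _ (hφ.pd j),
      hasWeakPartial_of_contDiffOn hG (contDiffOn_pd hG hu j) j _ hφ, neg_neg]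
  have i1 : ∀ j, IntegrableOn (fun y => u y * pd j (pd j φ) y) G := fun j =>
    (integrable_mul_of_tsupport_subset hG hu.continuousOn ((hφ.pd j).pd j).1.continuous
      ((hφ.pd j).pd j).2.1 ((hφ.pd j).pd j).2.2).integrableOn
  have i2 : ∀ j, IntegrableOn (fun y => pd j (pd j u) y * φ y) G := fun j =>
    (integrable_mul_of_tsupport_subset hG
      (contDiffOn_pd hG (contDiffOn_pd hG hu j) j).continuousOn hφ.1.continuous
      hφ.2.1 hφ.2.2).integrableOn
  calc ∫ y in G, u y * Laplacian.laplacian φ y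
      = ∫ y in G, (u y * pd 0 (pd 0 φ) y + u y * pd 1 (pd 1 φ) y) := by
        refine integral_congr_ae (.of_forall fun y => ?_)
        simp only [laplacian_eq_sum_pd hφ.1.contDiffAt, mul_add]
    _ = ∫ y in G, (pd 0 (pd 0 u) y * φ y + pd 1 (pd 1 u) y * φ y) := by
        rw [integral_add (i1 0) (i1 1), integral_add (i2 0) (i2 1), key, key]
    _ = _ := by
        refine setIntegral_congr_fun hG.measurableSet fun y hy => ?_
        simp only [laplacian_eq_sum_pd (hu.contDiffAt (hG.mem_nhds hy)), add_mul]

theorem InL2.locallyIntegrableOn {G : Set Plane} {v : Plane → ℝ} (h : InL2 G v) :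
    LocallyIntegrableOn v G := by
  intro x _
  refine ⟨Metric.ball x 1 ∩ G, inter_mem (mem_nhdsWithin_of_mem_nhds (Metric.ball_mem_nhds x one_pos))
    self_mem_nhdsWithin, ?_⟩
  have hfin : volume (Metric.ball x 1 ∩ G) ≠ ⊤ :=
    ((measure_mono inter_subset_left).trans_lt measure_ball_lt_top).ne
  have : IsFiniteMeasure (volume.restrict (Metric.ball x 1 ∩ G)) :=
    ⟨by simpa using hfin.lt_top⟩
  exact (h.mono_measure (Measure.restrict_mono inter_subset_right le_rfl)).integrable one_le_two

/-- Uniqueness of weak derivatives. -/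
theorem HasWeakPartial.ae_eq {G : Set Plane} (hG : IsOpen G) {j : Fin 2} {u u' v w : Plane → ℝ}
    (hv : HasWeakPartial G j u v) (hw : HasWeakPartial G j u' w)
    (huu : u =ᵐ[volume.restrict G] u')
    (iv : LocallyIntegrableOn v G) (iw : LocallyIntegrableOn w G) :
    v =ᵐ[volume.restrict G] w := by
  have int : ∀ {f : Plane → ℝ} (_ : LocallyIntegrableOn f G) {φ : Plane → ℝ} (_ : IsTest G φ),
      Integrable (fun y => f y * φ y) := by
    intro f hf φ hφ
    have hK : IntegrableOn f (tsupport φ) := hf.integrableOn_compact_subset hφ.2.2 hφ.2.1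
    have h1 : IntegrableOn (fun y => f y * φ y) (tsupport φ) :=
      hK.mul_continuousOn hφ.1.continuous.continuousOn hφ.2.1
    refine (integrableOn_iff_integrable_of_support_subset ?_).1 h1
    exact (Function.support_mul_subset_right _ _).trans (subset_tsupport _)
  have h := hG.ae_eq_zero_of_integral_contDiff_smul_eq_zero (μ := volume) (iv.sub iw)
    fun φ h1 h2 h3 => by
      have hφ : IsTest G φ := ⟨h1, h2, h3⟩
      have e1 := hv φ hφ
      have e2 := hw φ hφ
      have e3 : ∫ y in G, u y * NonlocalProblem.pd j φ y
          = ∫ y in G, u' y * NonlocalProblem.pd j φ y :=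
        integral_congr_ae (by filter_upwards [huu] with y hy; rw [hy])
      rw [setIntegral_mul_eq_integral h3] at e1 e2
      calc ∫ y, φ y • (v - w) y = ∫ y, (v y * φ y - w y * φ y) := by
            refine integral_congr_ae (.of_forall fun y => ?_)
            simp only [smul_eq_mul, Pi.sub_apply]; ring
        _ = 0 := by rw [integral_sub (int iv hφ) (int iw hφ)]; linarith
  filter_upwards [(ae_restrict_iff' hG.measurableSet).2 h] with y hy
  exact sub_eq_zero.1 hy

/-- Uniqueness of weak derivatives, used twice, identifies the classical second derivatives with the
weak ones, so failure of W^2 can be tested on classical derivatives. -/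
theorem inL2_pd_pd_of_inSobolev_two {G : Set Plane} (hG : IsOpen G) {u : Plane → ℝ}
    (hu : ContDiffOn ℝ ∞ u G) (h : InSobolev G 2 u) (j k : Fin 2) :
    InL2 G (pd k (pd j u)) := by
  obtain ⟨v, hv, hv1⟩ := h.2 j
  obtain ⟨w, hw, hw0⟩ := hv1.2 k
  have c1 := (contDiffOn_pd hG hu j)
  have c2 := (contDiffOn_pd hG c1 k).continuousOn
  have e1 := hv.ae_eq hG (hasWeakPartial_of_contDiffOn hG hu j) (ae_eq_refl _)
    (InL2.locallyIntegrableOn hv1.1) (c1.continuousOn.locallyIntegrableOn hG.measurableSet)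
  have e2 := hw.ae_eq hG (hasWeakPartial_of_contDiffOn hG c1 k) e1
    (InL2.locallyIntegrableOn hw0) (c2.locallyIntegrableOn hG.measurableSet)
  exact MemLp.ae_eq e2 hw0

/-- The second derivative in every direction of a function in `W^2` is square integrable. -/
theorem inL2_iteratedFDeriv_two_of_inSobolev_two {G : Set Plane} (hG : IsOpen G)
    {u : Plane → ℝ} (hu : ContDiffOn ℝ ∞ u G) (h : InSobolev G 2 u) (n : Plane) :
    InL2 G (fun y => iteratedFDeriv ℝ 2 u y ![n, n]) := by
  have e : ∀ y ∈ G, n 0 * n 0 * pd 0 (pd 0 u) y + n 0 * n 1 * pd 0 (pd 1 u) y +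
      (n 1 * n 0 * pd 1 (pd 0 u) y + n 1 * n 1 * pd 1 (pd 1 u) y)
      = iteratedFDeriv ℝ 2 u y ![n, n] := by
    intro y hy
    have hc := hu.contDiffAt (hG.mem_nhds hy)
    simp only [pd_pd_eq hc, iteratedFDeriv_two_apply]
    have hn : n = n 0 • EuclideanSpace.single 0 1 + n 1 • EuclideanSpace.single 1 1 := by
      ext i; fin_cases i <;> simp
    simp only [Matrix.cons_val_zero, Matrix.cons_val_one]
    conv_rhs => rw [hn]
    simp only [map_add, map_smul, add_apply, smul_apply, smul_eq_mul]
    ring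
  have i := fun j k => inL2_pd_pd_of_inSobolev_two hG hu h j k
  refine MemLp.ae_eq ((ae_restrict_iff' hG.measurableSet).2 (.of_forall e)) ?_
  exact (((i 0 0).const_mul _).add ((i 1 0).const_mul _)).add
    (((i 0 1).const_mul _).add ((i 1 1).const_mul _))

/-! ### Square integrability under power growth -/

/-- In polar coordinates the squared norm is a multiple of ∫ r^(2ν+1) dr, which converges at 0
because ν > -1. -/
theorem memLp_norm_sub_rpow (p : Plane) (R : ℝ) {ν : ℝ} (hν : -1 < ν) :
    MemLp (fun y : Plane => ‖y - p‖ ^ ν) 2 (volume.restrict (Metric.ball p R)) := by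
  rw [memLp_two_iff_integrable_sq]
  swap
  · exact ((measurable_id.sub_const p).norm.pow_const ν).aestronglyMeasurable
  have h0 : IntegrableOn (fun y : Plane => (‖y‖ ^ ν) ^ 2) (Metric.ball 0 R) := by
    rw [integrableOn_fun_norm_addHaar volume (f := fun r => (r ^ ν) ^ 2)]
    have h1 : IntegrableOn (fun r : ℝ => r ^ (2 * ν + 1)) (Ioo 0 R) := by
      rcases le_or_gt R 0 with hR | hR
      · simp [Ioo_eq_empty_of_le hR]
      · exact (intervalIntegral.integrableOn_Ioo_rpow_iff hR).2 (by linarith)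
    refine h1.congr_fun (fun r hr => ?_) measurableSet_Ioo
    simp only [finrank_euclideanSpace, Fintype.card_fin, smul_eq_mul]
    rw [Real.rpow_add hr.1, mul_comm 2 ν, Real.rpow_mul hr.1.le]
    simp [mul_comm]
  have hm := measurePreserving_sub_right (volume : Measure Plane) p
  have h2 := (hm.integrableOn_comp_preimage
    (Homeomorph.subRight p).measurableEmbedding).2 h0
  have e : (fun x => x - p) ⁻¹' Metric.ball (0 : Plane) R = Metric.ball p R := by
    ext y; simp [dist_eq_norm]
  rw [e] at h2
  exact h2

/-- A function on a bounded domain which is continuous off a point outside the domain, and grows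
near this point more slowly than `1/r`, is square integrable. -/
theorem inL2_of_le_rpow {G : Set Plane} (hG : IsOpen G) (hb : Bornology.IsBounded G) {p : Plane}
    (hp : p ∉ G) {w : Plane → ℝ} (hw : ContinuousOn w {p}ᶜ) {ν : ℝ} (hν : -1 < ν)
    {δ K : ℝ} (hδ : 0 < δ) (hK : ∀ y ∈ G, ‖y - p‖ < δ → ‖w y‖ ≤ K * ‖y - p‖ ^ ν) :
    InL2 G w := by
  have hpG : G ⊆ {p}ᶜ := fun y hy h => hp (h ▸ hy)
  have hcpt : IsCompact (closure G \ Metric.ball p δ) :=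
    hb.isCompact_closure.diff Metric.isOpen_ball
  obtain ⟨M, hM⟩ := hcpt.exists_bound_of_continuousOn (hw.mono fun y hy h => hy.2 (by
    rw [mem_singleton_iff.1 h]; exact Metric.mem_ball_self hδ))
  obtain ⟨R, hR⟩ := hb.subset_ball p
  have hfin : IsFiniteMeasure (volume.restrict G) :=
    ⟨by simpa using hb.measure_lt_top⟩
  have h1 : MemLp (fun y => |K| * ‖y - p‖ ^ ν + |M|) 2 (volume.restrict G) :=
    (((memLp_norm_sub_rpow p R hν).mono_measure (Measure.restrict_mono hR le_rfl)).const_mul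
      |K|).add (memLp_const |M|)
  refine h1.mono' ((hw.mono hpG).aestronglyMeasurable hG.measurableSet) ?_
  refine (ae_restrict_iff' hG.measurableSet).2 (.of_forall fun y hy => ?_)
  have hr : 0 ≤ ‖y - p‖ ^ ν := Real.rpow_nonneg (norm_nonneg _) _
  by_cases hyδ : ‖y - p‖ < δ
  · have := hK y hy hyδ
    nlinarith [le_abs_self K, abs_nonneg M]
  · have := hM y ⟨subset_closure hy, by simpa [dist_eq_norm] using hyδ⟩
    have := mul_nonneg (abs_nonneg K) hr
    linarith [le_abs_self M]

theorem HasOrder.norm_le {p : Plane} {μ : ℝ} {u : Plane → ℝ} (h : HasOrder p μ u) :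
    ∃ K, 0 ≤ K ∧ ∀ y, y ≠ p → ‖y - p‖ ≤ 1 → ‖u y‖ ≤ K * ‖y - p‖ ^ μ := by
  obtain ⟨K, hK, hb⟩ := h.2 0
  exact ⟨K, hK, fun y hy h1 => by simpa using hb y hy h1⟩

theorem HasOrder.norm_fderiv_le {p : Plane} {μ : ℝ} {u : Plane → ℝ} (h : HasOrder p μ u) :
    ∃ K, 0 ≤ K ∧ ∀ y, y ≠ p → ‖y - p‖ ≤ 1 → ‖fderiv ℝ u y‖ ≤ K * ‖y - p‖ ^ (μ - 1) := by
  obtain ⟨K, hK, hb⟩ := h.2 1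
  exact ⟨K, hK, fun y hy h1 => by simpa using hb y hy h1⟩

theorem HasOrder.abs_iteratedFDeriv_two_le {p : Plane} {μ : ℝ} {u : Plane → ℝ}
    (h : HasOrder p μ u) : ∃ K, 0 ≤ K ∧ ∀ y, y ≠ p → ‖y - p‖ ≤ 1 → ∀ n : Plane, ‖n‖ ≤ 1 →
      ‖iteratedFDeriv ℝ 2 u y ![n, n]‖ ≤ K * ‖y - p‖ ^ (μ - 2) := by
  obtain ⟨K, hK, hb⟩ := h.2 2
  refine ⟨K, hK, fun y hy h1 n hn => ?_⟩
  have h2 := (iteratedFDeriv ℝ 2 u y).le_opNorm ![n, n]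
  simp only [Fin.prod_univ_two, Matrix.cons_val_zero, Matrix.cons_val_one] at h2
  have h3 := hb y hy h1
  push_cast at h3
  have h4 : ‖n‖ * ‖n‖ ≤ 1 := mul_le_one₀ hn (norm_nonneg _) hn
  calc _ ≤ _ := h2
    _ ≤ ‖iteratedFDeriv ℝ 2 u y‖ * 1 := by gcongr
    _ ≤ _ := by rw [mul_one]; exact h3

theorem HasOrder.continuous {p : Plane} {μ : ℝ} {u : Plane → ℝ} (h : HasOrder p μ u) (hμ : 0 < μ)
    (h0 : u p = 0) : Continuous u := by
  refine continuous_iff_continuousAt.2 fun y => ?_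
  by_cases hy : y = p
  swap
  · exact (h.contDiffAt hy).continuousAt
  subst hy
  obtain ⟨K, hK, hb⟩ := h.norm_le
  have ht : Tendsto (fun x : Plane => K * ‖x - y‖ ^ μ) (𝓝 y) (𝓝 0) := by
    have : ContinuousAt (fun x : Plane => K * ‖x - y‖ ^ μ) y := by
      refine continuousAt_const.mul (ContinuousAt.rpow_const (by fun_prop) (Or.inr hμ.le))
    simpa [ContinuousAt, Real.zero_rpow hμ.ne'] using this
  rw [ContinuousAt, h0]
  refine squeeze_zero_norm' ?_ ht
  filter_upwards [Metric.closedBall_mem_nhds y one_pos] with x hx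
  by_cases hxy : x = y
  · simp [hxy, h0, Real.zero_rpow hμ.ne']
  · exact hb x hxy (by simpa [dist_eq_norm] using hx)

theorem pd_norm_le (j : Fin 2) (u : Plane → ℝ) (y : Plane) : ‖pd j u y‖ ≤ ‖fderiv ℝ u y‖ := by
  have := (fderiv ℝ u y).le_opNorm (EuclideanSpace.single j 1)
  simpa [pd] using this

theorem HasOrder.inL2_pd {G : Set Plane} (hG : IsOpen G) (hb : Bornology.IsBounded G) {p : Plane}
    (hp : p ∉ G) {μ : ℝ} (hμ : 0 < μ) {u : Plane → ℝ} (h : HasOrder p μ u) (j : Fin 2) :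
    InL2 G (pd j u) := by
  obtain ⟨K, hK, hKb⟩ := h.norm_fderiv_le
  refine inL2_of_le_rpow hG hb hp (contDiffOn_pd isOpen_compl_singleton h.1 j).continuousOn
    (ν := μ - 1) (by linarith) one_pos (K := K) fun y hy h1 => ?_
  exact (pd_norm_le j u y).trans (hKb y (fun e => hp (e ▸ hy)) h1.le)

theorem HasOrder.inL2 {G : Set Plane} (hG : IsOpen G) (hb : Bornology.IsBounded G) {p : Plane}
    (hp : p ∉ G) {μ : ℝ} (hμ : 0 < μ) {u : Plane → ℝ} (h : HasOrder p μ u) : InL2 G u := by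
  obtain ⟨K, hK, hKb⟩ := h.norm_le
  exact inL2_of_le_rpow hG hb hp h.1.continuousOn
    (ν := μ) (by linarith) one_pos (K := K) fun y hy h1 => hKb y (fun e => hp (e ▸ hy)) h1.le

theorem contDiffOn_of_notMem {G : Set Plane} {p : Plane} {u : Plane → ℝ}
    (h : ContDiffOn ℝ ∞ u {p}ᶜ) (hp : p ∉ G) : ContDiffOn ℝ ∞ u G :=
  h.mono fun _ hy e => hp (mem_singleton_iff.1 e ▸ hy)

/-- A function which is smooth off a point outside a bounded domain, near which it is of positive
order, belongs to `W^1`. -/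
theorem HasOrder.inSobolev_one {G : Set Plane} (hG : IsOpen G) (hb : Bornology.IsBounded G)
    {p : Plane} (hp : p ∉ G) {μ : ℝ} (hμ : 0 < μ) {u : Plane → ℝ} (h : HasOrder p μ u) :
    InSobolev G 1 u :=
  ⟨h.inL2 hG hb hp hμ, fun j => ⟨pd j u,
    hasWeakPartial_of_contDiffOn hG (contDiffOn_of_notMem h.1 hp) j, h.inL2_pd hG hb hp hμ j⟩⟩

/-! ### Smooth approximation and traces -/

/-- A smooth function which vanishes near the origin and equals `1` far from it. -/
noncomputable def annulusCutoff (x : Plane) : ℝ := Real.smoothTransition (‖x‖ ^ 2 - 1)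

theorem contDiff_annulusCutoff : ContDiff ℝ ∞ annulusCutoff :=
  Real.smoothTransition.contDiff.comp ((contDiff_norm_sq ℝ).sub contDiff_const)

theorem annulusCutoff_of_le {x : Plane} (h : ‖x‖ ≤ 1) : annulusCutoff x = 0 :=
  Real.smoothTransition.zero_of_nonpos (by nlinarith [norm_nonneg x])

theorem annulusCutoff_of_ge {x : Plane} (h : 3 / 2 ≤ ‖x‖) : annulusCutoff x = 1 :=
  Real.smoothTransition.one_of_one_le (by nlinarith)

theorem abs_annulusCutoff_sub_one_le (x : Plane) : ‖annulusCutoff x - 1‖ ≤ 1 := by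
  have h1 := Real.smoothTransition.nonneg (‖x‖ ^ 2 - 1)
  have h2 := Real.smoothTransition.le_one (‖x‖ ^ 2 - 1)
  rw [Real.norm_eq_abs, abs_le, annulusCutoff]
  constructor <;> linarith

theorem exists_norm_fderiv_annulusCutoff_le :
    ∃ M, 0 ≤ M ∧ ∀ x : Plane, ‖fderiv ℝ annulusCutoff x‖ ≤ M := by
  obtain ⟨M, hM0, hM⟩ : ∃ M, 0 ≤ M ∧ ∀ x : Plane, ‖x‖ ≤ 2 → ‖fderiv ℝ annulusCutoff x‖ ≤ M := by
    have hc : Continuous (fderiv ℝ annulusCutoff) :=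
      contDiff_annulusCutoff.continuous_fderiv (by simp)
    obtain ⟨M, hM⟩ := (isCompact_closedBall (0 : Plane) 2).exists_bound_of_continuousOn
      hc.continuousOn
    exact ⟨M, (norm_nonneg _).trans (hM 0 (by simp)), fun x hx => hM x (by simpa using hx)⟩
  refine ⟨M, hM0, fun x => ?_⟩
  by_cases hx : ‖x‖ ≤ 2
  · exact hM x hx
  have : annulusCutoff =ᶠ[𝓝 x] fun _ => 1 := by
    filter_upwards [continuous_norm.continuousAt.eventually (lt_mem_nhds (not_le.1 hx))] with z hz
    exact annulusCutoff_of_ge (by linarith)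
  rw [this.fderiv_eq]
  simpa using hM0

/-- The smooth approximation of `u` which is obtained by cutting off a disc of radius `1/s`
about `p`. -/
noncomputable def cutNear (p : Plane) (s : ℝ) (u : Plane → ℝ) (y : Plane) : ℝ :=
  u y * annulusCutoff (s • (y - p))

theorem contDiff_cutoff_comp (p : Plane) (s : ℝ) :
    ContDiff ℝ ∞ (fun y => annulusCutoff (s • (y - p))) :=
  contDiff_annulusCutoff.comp (by fun_prop)

theorem contDiff_cutNear {p : Plane} {u : Plane → ℝ} (h : ContDiffOn ℝ ∞ u {p}ᶜ) (s : ℝ) :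
    ContDiff ℝ ∞ (cutNear p s u) := by
  refine contDiff_iff_contDiffAt.2 fun y => ?_
  by_cases hy : y = p
  swap
  · exact (h.contDiffAt (isOpen_compl_singleton.mem_nhds hy)).mul
      (contDiff_cutoff_comp p s).contDiffAt
  have : cutNear p s u =ᶠ[𝓝 y] fun _ => 0 := by
    have hc : ContinuousAt (fun z : Plane => ‖s • (z - p)‖) y := by fun_prop
    filter_upwards [hc.eventually (gt_mem_nhds (show _ < 1 by simp [hy]))] with z hz
    simp [cutNear, annulusCutoff_of_le hz.le]
  exact contDiffAt_const.congr_of_eventuallyEq this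

theorem cutNear_eq {p : Plane} {u : Plane → ℝ} {s : ℝ} (hs : 0 < s) {y : Plane}
    (hy : 3 / 2 / s ≤ ‖y - p‖) : cutNear p s u y = u y := by
  rw [cutNear, annulusCutoff_of_ge, mul_one]
  rw [norm_smul, Real.norm_of_nonneg hs.le]
  rwa [div_le_iff₀' hs] at hy

theorem HasOrder.norm_cutNear_sub_le {p : Plane} {μ : ℝ} (hμ : 0 < μ) {u : Plane → ℝ}
    (h : HasOrder p μ u) (h0 : u p = 0) :
    ∃ K, 0 ≤ K ∧ ∀ s, 2 ≤ s → ∀ y, ‖cutNear p s u y - u y‖ ≤ K * (2 / s) ^ μ := by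
  obtain ⟨K, hK, hKb⟩ := h.norm_le
  refine ⟨K, hK, fun s hs y => ?_⟩
  have hs0 : 0 < s := by linarith
  have hnn : 0 ≤ K * (2 / s) ^ μ := by positivity
  by_cases hy : y = p
  · simpa [hy, cutNear, h0] using hnn
  rcases le_or_gt (2 / s) ‖y - p‖ with hr | hr
  · have : 3 / 2 / s ≤ 2 / s := by gcongr; norm_num
    simpa [cutNear_eq hs0 (this.trans hr)] using hnn
  have h1 : 2 / s ≤ 1 := (div_le_one hs0).2 hs
  calc ‖cutNear p s u y - u y‖ = ‖u y‖ * ‖annulusCutoff (s • (y - p)) - 1‖ := by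
        rw [← norm_mul, cutNear]; ring_nf
    _ ≤ (K * ‖y - p‖ ^ μ) * 1 := by
        gcongr
        · exact hKb y hy (hr.le.trans h1)
        · exact abs_annulusCutoff_sub_one_le _
    _ ≤ _ := by rw [mul_one]; gcongr

/-- The cutoff has gradient of size s, but only where s‖y - p‖ ≤ 2; there the factor s costs no more
than one power of the distance, as differentiating u does. The bound is uniform in s up to the
shrinking indicator. -/
theorem HasOrder.norm_pd_cutNear_sub_le {p : Plane} {μ : ℝ} {u : Plane → ℝ}
    (h : HasOrder p μ u) : ∃ K, 0 ≤ K ∧ ∀ s, 2 ≤ s → ∀ y, y ≠ p → ∀ j,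
      ‖pd j (cutNear p s u) y - pd j u y‖ ≤
        (Metric.closedBall p (2 / s)).indicator (fun y => K * ‖y - p‖ ^ (μ - 1)) y := by
  obtain ⟨K, hK, hKb⟩ := h.norm_le
  obtain ⟨K', hK', hKb'⟩ := h.norm_fderiv_le
  obtain ⟨M, hM, hMb⟩ := exists_norm_fderiv_annulusCutoff_le
  refine ⟨K * (2 * M) + K', by positivity, fun s hs y hy j => ?_⟩
  have hs0 : 0 < s := by linarith
  have hr := norm_sub_pos_of_ne hy
  by_cases hy2 : y ∈ Metric.closedBall p (2 / s)
  swap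
  · have e : cutNear p s u =ᶠ[𝓝 y] u := by
      filter_upwards [Metric.isClosed_closedBall.isOpen_compl.mem_nhds hy2] with z hz
      refine cutNear_eq hs0 ?_
      simp only [mem_compl_iff, Metric.mem_closedBall, dist_eq_norm, not_le] at hz
      have : 3 / 2 / s ≤ 2 / s := by gcongr; norm_num
      linarith
    simp [pd, e.fderiv_eq, indicator_of_notMem hy2]
  rw [indicator_of_mem hy2]
  rw [Metric.mem_closedBall, dist_eq_norm] at hy2
  have h1 : 2 / s ≤ 1 := (div_le_one hs0).2 hs
  have hsr : s * ‖y - p‖ ≤ 2 := by rwa [le_div_iff₀' hs0] at hy2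
  have hud : DifferentiableAt ℝ u y := (h.contDiffAt hy).differentiableAt (by simp)
  have hcd : DifferentiableAt ℝ (fun y => annulusCutoff (s • (y - p))) y :=
    (contDiff_cutoff_comp p s).differentiable (by simp) y
  have hcf : ‖fderiv ℝ (fun y => annulusCutoff (s • (y - p))) y‖ ≤ M * s := by
    have hd : HasFDerivAt (fun y : Plane => s • (y - p)) (s • ContinuousLinearMap.id ℝ Plane) y :=
      ((hasFDerivAt_id y).sub_const p).const_smul s
    have hg := (contDiff_annulusCutoff.differentiable (by simp) (s • (y - p))).hasFDerivAt.comp y hd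
    rw [show (fun y => annulusCutoff (s • (y - p))) = annulusCutoff ∘ fun y => s • (y - p) from rfl,
      hg.fderiv]
    refine (ContinuousLinearMap.opNorm_comp_le _ _).trans ?_
    gcongr
    · exact hMb _
    · rw [norm_smul, Real.norm_of_nonneg hs0.le]
      exact mul_le_of_le_one_right hs0.le ContinuousLinearMap.norm_id_le
  have e : fderiv ℝ (cutNear p s u) y - fderiv ℝ u y =
      u y • fderiv ℝ (fun y => annulusCutoff (s • (y - p))) y +
        (annulusCutoff (s • (y - p)) - 1) • fderiv ℝ u y := by
    have := fderiv_mul hud hcd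
    have e2 : cutNear p s u = u * fun y => annulusCutoff (s • (y - p)) := rfl
    rw [e2, this, sub_smul, one_smul]
    abel
  have e3 : pd j (cutNear p s u) y - pd j u y =
      (fderiv ℝ (cutNear p s u) y - fderiv ℝ u y) (EuclideanSpace.single j 1) := rfl
  have e4 : ‖y - p‖ ^ μ * s ≤ 2 * ‖y - p‖ ^ (μ - 1) := by
    have : ‖y - p‖ ^ μ = ‖y - p‖ ^ (μ - 1) * ‖y - p‖ := by
      rw [← Real.rpow_add_one hr.ne']; simp
    rw [this]
    have : 0 ≤ ‖y - p‖ ^ (μ - 1) := by positivity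
    nlinarith
  calc _ ≤ ‖fderiv ℝ (cutNear p s u) y - fderiv ℝ u y‖ := by
        rw [e3]
        simpa using (fderiv ℝ (cutNear p s u) y - fderiv ℝ u y).le_opNorm
          (EuclideanSpace.single j 1)
    _ ≤ (K * ‖y - p‖ ^ μ) * (M * s) + 1 * (K' * ‖y - p‖ ^ (μ - 1)) := by
        rw [e]
        refine (norm_add_le _ _).trans ?_
        rw [norm_smul, norm_smul]
        gcongr
        · exact hKb y hy (hy2.trans h1)
        · exact abs_annulusCutoff_sub_one_le _
        · exact hKb' y hy (hy2.trans h1)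
    _ = K * M * (‖y - p‖ ^ μ * s) + K' * ‖y - p‖ ^ (μ - 1) := by ring
    _ ≤ K * M * (2 * ‖y - p‖ ^ (μ - 1)) + K' * ‖y - p‖ ^ (μ - 1) := by gcongr
    _ = _ := by ring

theorem tendsto_two_div_nat : Tendsto (fun n : ℕ => 2 / ((n : ℝ) + 2)) atTop (𝓝 0) :=
  tendsto_const_nhds.div_atTop (tendsto_natCast_atTop_atTop.atTop_add tendsto_const_nhds)

theorem tendsto_eLpNorm_of_bound {α : Type*} [MeasurableSpace α] {μ : Measure α}
    [IsFiniteMeasure μ] {f : ℕ → α → ℝ} {C : ℕ → ℝ} (hC : Tendsto C atTop (𝓝 0))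
    (hf : ∀ n x, ‖f n x‖ ≤ C n) : Tendsto (fun n => eLpNorm (f n) 2 μ) atTop (𝓝 0) := by
  have hb : ∀ n, eLpNorm (f n) 2 μ ≤ μ univ ^ (2 : ENNReal).toReal⁻¹ * ENNReal.ofReal (C n) :=
    fun n => eLpNorm_le_of_ae_bound (.of_forall (hf n))
  have ht : Tendsto (fun n => μ univ ^ (2 : ENNReal).toReal⁻¹ * ENNReal.ofReal (C n)) atTop
      (𝓝 0) := by
    have := ENNReal.Tendsto.const_mul (a := μ univ ^ (2 : ENNReal).toReal⁻¹)
      (ENNReal.tendsto_ofReal hC) (Or.inr (by finiteness))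
    simpa using this
  exact tendsto_of_tendsto_of_tendsto_of_le_of_le tendsto_const_nhds ht (fun _ => zero_le) hb

theorem tendsto_volume_closedBall (p : Plane) :
    Tendsto (fun n : ℕ => volume (Metric.closedBall p (2 / ((n : ℝ) + 2)))) atTop (𝓝 0) := by
  have e : ∀ n : ℕ, volume (Metric.closedBall p (2 / ((n : ℝ) + 2))) =
      ENNReal.ofReal ((2 / ((n : ℝ) + 2)) ^ 2) * volume (Metric.ball (0 : Plane) 1) := by
    intro n
    have := Measure.addHaar_closedBall (volume : Measure Plane) p
      (show 0 ≤ 2 / ((n : ℝ) + 2) by positivity)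
    simpa using this
  simp only [e]
  have := ENNReal.Tendsto.mul_const (b := volume (Metric.ball (0 : Plane) 1))
    (ENNReal.tendsto_ofReal (tendsto_two_div_nat.pow 2)) (Or.inr measure_ball_lt_top.ne)
  simpa using this

/-- The values converge uniformly. The gradients differ only on shrinking discs, by at most a fixed
L₂ function. The shift `n + 2` meets the condition 2 ≤ s of the preceding bounds. -/
theorem HasOrder.tendstoW1_cutNear {G : Set Plane} (hG : IsOpen G) (hb : Bornology.IsBounded G)
    {p : Plane} (hp : p ∉ G) {μ : ℝ} (hμ : 0 < μ) {u : Plane → ℝ} (h : HasOrder p μ u)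
    (h0 : u p = 0) : TendstoW1 G (fun n : ℕ => cutNear p (n + 2) u) u := by
  have hfin : IsFiniteMeasure (volume.restrict G) := ⟨by simpa using hb.measure_lt_top⟩
  constructor
  · obtain ⟨K, hK, hKb⟩ := h.norm_cutNear_sub_le hμ h0
    have hC : Tendsto (fun n : ℕ => K * (2 / ((n : ℝ) + 2)) ^ μ) atTop (𝓝 0) := by
      simpa [Real.zero_rpow hμ.ne'] using
        (tendsto_two_div_nat.rpow_const (Or.inr hμ.le)).const_mul K
    exact tendsto_eLpNorm_of_bound hC fun n y =>
      hKb (n + 2) (by linarith [n.cast_nonneg (α := ℝ)]) y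
  · intro j
    refine ⟨pd j u, h.inL2_pd hG hb hp hμ j,
      hasWeakPartial_of_contDiffOn hG (contDiffOn_of_notMem h.1 hp) j, ?_⟩
    obtain ⟨K, hK, hKb⟩ := h.norm_pd_cutNear_sub_le
    obtain ⟨R, hR⟩ := hb.subset_ball p
    have hm : MemLp (fun y => K * ‖y - p‖ ^ (μ - 1)) 2 (volume.restrict G) :=
      ((memLp_norm_sub_rpow p R (by linarith)).mono_measure
        (Measure.restrict_mono hR le_rfl)).const_mul K
    refine ENNReal.tendsto_nhds_zero.2 fun ε hε => ?_
    obtain ⟨ε', hε', hεε⟩ : ∃ ε' : ℝ, 0 < ε' ∧ ENNReal.ofReal ε' ≤ ε := by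
      rcases eq_or_ne ε ⊤ with rfl | hne
      · exact ⟨1, one_pos, le_top⟩
      · exact ⟨ε.toReal, ENNReal.toReal_pos hε.ne' hne, by rw [ENNReal.ofReal_toReal hne]⟩
    -- Absolute continuity of the integral: the L₂ norm of the dominating function is small on every
    -- set of small measure.
    obtain ⟨δ, hδ, hδb⟩ := hm.eLpNorm_indicator_le one_le_two (by simp) hε'
    filter_upwards [(tendsto_volume_closedBall p).eventually
      (ge_mem_nhds (ENNReal.ofReal_pos.2 hδ))] with n hn
    refine le_trans ?_ ((hδb _ Metric.isClosed_closedBall.measurableSet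
      ((Measure.restrict_apply_le _ _).trans hn)).trans hεε)
    refine eLpNorm_mono_ae ((ae_restrict_iff' hG.measurableSet).2 (.of_forall fun y hy => ?_))
    refine (hKb (n + 2) (by linarith [n.cast_nonneg (α := ℝ)]) y
      (fun e => hp (e ▸ hy)) j).trans (le_abs_self _)

/-- The trace of a continuous function which is smooth off a point outside the domain, and of
positive order there, is its restriction. -/
theorem HasOrder.hasTraceAlong {G : Set Plane} (hG : IsOpen G) (hb : Bornology.IsBounded G)
    {p : Plane} (hp : p ∉ G) {μ : ℝ} (hμ : 0 < μ) {u : Plane → ℝ} (h : HasOrder p μ u)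
    (h0 : u p = 0) {M : ℝ} (hM : ∀ y, ‖u y‖ ≤ M) {c : ℝ → Plane} (hc : ContinuousOn c (Ioo 0 1)) :
    HasTraceAlong G u c (u ∘ c) := by
  refine ⟨?_, fun n : ℕ => cutNear p (n + 2) u, fun n => contDiff_cutNear h.1 _,
    h.tendstoW1_cutNear hG hb hp hμ h0, ?_⟩
  · exact MemLp.of_bound (((h.continuous hμ h0).comp_continuousOn hc).aestronglyMeasurable
      measurableSet_Ioo) M (.of_forall fun t => hM _)
  · obtain ⟨K, hK, hKb⟩ := h.norm_cutNear_sub_le hμ h0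
    have hC : Tendsto (fun n : ℕ => K * (2 / ((n : ℝ) + 2)) ^ μ) atTop (𝓝 0) := by
      simpa [Real.zero_rpow hμ.ne'] using
        (tendsto_two_div_nat.rpow_const (Or.inr hμ.le)).const_mul K
    exact tendsto_eLpNorm_of_bound hC fun n t =>
      hKb (n + 2) (by linarith [n.cast_nonneg (α := ℝ)]) (c t)

/-! ### A criterion for not belonging to W^2 -/

theorem natCast_le_infty (k : ℕ) : (k : WithTop ℕ∞) ≤ ∞ := by exact_mod_cast le_top

/-- A function is not in `W^2` on a domain containing small discs tending to `p` inside a cone, if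
its leading term at `p` is homogeneous of degree `μ < 1` and has a nonzero second derivative at the
axis of the cone. -/
theorem not_inSobolev_two_of_homogeneous {G : Set Plane} (hG : IsOpen G) {p : Plane}
    (hp : p ∉ G) {μ : ℝ} (hμ : μ < 1) {F R : Plane → ℝ} (hF : ContDiffOn ℝ ∞ F {0}ᶜ)
    (hom : ∀ t : ℝ, 0 < t → ∀ x, F (t • x) = t ^ μ * F x) (hR : HasOrder p (μ + 1) R)
    {n : Plane} (hn : ‖n‖ = 1) (hFn : iteratedFDeriv ℝ 2 F n ![n, n] ≠ 0)
    {κ δ : ℝ} (hκ : 0 < κ) (hδ : 0 < δ)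
    (hcone : ∀ t, 0 < t → t < δ → Metric.ball (p + t • n) (κ * t) ⊆ G) :
    ¬ InSobolev G 2 (fun y => F (y - p) + R y) := by
  intro hW
  have hn0 : n ≠ 0 := by rintro rfl; simp at hn
  have hFp := HasOrder.of_homogeneous hF hom p
  have hsm := hFp.1.add hR.1
  have hL2 := inL2_iteratedFDeriv_two_of_inSobolev_two hG (contDiffOn_of_notMem hsm hp) hW n
  have hint : IntegrableOn (fun y => (iteratedFDeriv ℝ 2 (fun y => F (y - p) + R y) y ![n, n]) ^ 2)
      G := hL2.integrable_sq
  set h : Plane → ℝ := fun y => iteratedFDeriv ℝ 2 (fun y => F (y - p) + R y) y ![n, n] with hh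
  have ho : IsOpen ({0}ᶜ : Set Plane) := isOpen_compl_singleton
  -- By continuity the second derivative of F stays away from 0 on a small disc about n. The bound
  -- κ' ≤ 1/2 keeps the rescaled discs at distance at least t/2 from p.
  obtain ⟨c, hc, κ', hκ', hκ1, hκ2, hlow⟩ : ∃ c, 0 < c ∧ ∃ κ', 0 < κ' ∧ κ' ≤ κ ∧ κ' ≤ 1 / 2 ∧
      ∀ x ∈ Metric.ball n κ', c ≤ ‖iteratedFDeriv ℝ 2 F x ![n, n]‖ := by
    have hca : ContinuousAt (fun x => ‖iteratedFDeriv ℝ 2 F x ![n, n]‖) n := by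
      have h1 : ContinuousAt (iteratedFDeriv ℝ 2 F) n :=
        ((hF.contDiffAt (ho.mem_nhds hn0)).iteratedFDeriv_right (m := 0) (i := 2)
          (by norm_cast)).continuousAt
      exact ((ContinuousMultilinearMap.apply ℝ (fun _ : Fin 2 => Plane) ℝ
        ![n, n]).continuous.continuousAt.comp h1).norm
    have hpos := norm_pos_iff.2 hFn
    obtain ⟨ε, hε, hεb⟩ := Metric.eventually_nhds_iff_ball.1
      (hca.eventually (lt_mem_nhds (half_lt_self hpos)))
    refine ⟨_, half_pos hpos, min ε (min κ (1 / 2)), by positivity,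
      (min_le_right _ _).trans (min_le_left _ _), (min_le_right _ _).trans (min_le_right _ _),
      fun x hx => (hεb x (Metric.ball_subset_ball (min_le_left _ _) hx)).le⟩
  obtain ⟨K, hK, hKb⟩ := hR.abs_iteratedFDeriv_two_le
  set V := volume.real (Metric.ball (0 : Plane) 1) with hV
  have hVpos : 0 < V :=
    ENNReal.toReal_pos (Metric.measure_ball_pos _ _ one_pos).ne' measure_ball_lt_top.ne
  -- On the disc of radius κ't about p + tn the second derivative is at least (c/2) t^(μ-2);
  -- squaring and multiplying by the area, of order t², gives t^(2(μ-1)), which is unbounded as t →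
  -- 0 since μ < 1.
  have main : ∀ t, 0 < t → t < δ → t ≤ 1 / 2 → K * (1 / 2) ^ (μ - 1) * t ≤ c / 2 →
      (c / 2) ^ 2 * κ' ^ 2 * V * t ^ (2 * (μ - 1)) ≤ ∫ y in G, h y ^ 2 := by
    intro t ht htδ ht2 htK
    have hsub : Metric.ball (p + t • n) (κ' * t) ⊆ G :=
      (Metric.ball_subset_ball (by gcongr)).trans (hcone t ht htδ)
    have hpt : ∀ y ∈ Metric.ball (p + t • n) (κ' * t), (c / 2 * t ^ (μ - 2)) ^ 2 ≤ h y ^ 2 := by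
      intro y hy
      have hyp : y ≠ p := fun e => hp (e ▸ hsub hy)
      set x : Plane := t⁻¹ • (y - p) with hx
      have hyx : y - p = t • x := by rw [hx, smul_smul, mul_inv_cancel₀ ht.ne', one_smul]
      have hd : ‖y - p - t • n‖ < κ' * t := by
        rw [Metric.mem_ball, dist_eq_norm] at hy
        rwa [sub_sub]
      have hxn : x ∈ Metric.ball n κ' := by
        rw [hyx, ← smul_sub, norm_smul, Real.norm_of_nonneg ht.le, mul_comm] at hd
        rw [Metric.mem_ball, dist_eq_norm]
        exact lt_of_mul_lt_mul_right hd ht.le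
      have hx0 : x ≠ 0 := smul_ne_zero (inv_ne_zero ht.ne') (sub_ne_zero.2 hyp)
      have htn : ‖t • n‖ = t := by rw [norm_smul, hn, mul_one, Real.norm_of_nonneg ht.le]
      have hr1 : ‖y - p‖ ≤ 1 := by
        have : ‖y - p‖ ≤ ‖y - p - t • n‖ + ‖t • n‖ := by
          simpa using norm_add_le (y - p - t • n) (t • n)
        nlinarith
      have hr2 : 1 / 2 * t ≤ ‖y - p‖ := by
        have : ‖t • n‖ ≤ ‖y - p‖ + ‖y - p - t • n‖ := by
          simpa using norm_sub_le (y - p) (y - p - t • n)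
        nlinarith
      have e1 : h y = t ^ (μ - 2) * iteratedFDeriv ℝ 2 F x ![n, n] +
          iteratedFDeriv ℝ 2 R y ![n, n] := by
        have e2 : iteratedFDeriv ℝ 2 (fun y => F (y - p) + R y) y =
            iteratedFDeriv ℝ 2 (fun y => F (y - p)) y + iteratedFDeriv ℝ 2 R y :=
          iteratedFDeriv_add_apply ((hFp.contDiffAt hyp).of_le (natCast_le_infty 2))
            ((hR.contDiffAt hyp).of_le (natCast_le_infty 2))
        simp only [hh]
        rw [e2, iteratedFDeriv_comp_sub, hyx, iteratedFDeriv_smul_of_homogeneous hF hom 2 ht hx0]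
        simp
      -- The remainder is smaller than the leading term by a factor of order t, so for small t it
      -- uses up at most half of the lower bound c.
      have e3 : ‖iteratedFDeriv ℝ 2 R y ![n, n]‖ ≤ c / 2 * t ^ (μ - 2) := by
        refine (hKb y hyp hr1 n hn.le).trans ?_
        have e4 : ‖y - p‖ ^ (μ + 1 - 2) ≤ (1 / 2 * t) ^ (μ - 1) := by
          rw [show μ + 1 - 2 = μ - 1 by ring]
          exact Real.rpow_le_rpow_of_nonpos (by positivity) hr2 (by linarith)
        have e5 : t ^ (μ - 1) = t * t ^ (μ - 2) := by
          rw [mul_comm, ← Real.rpow_add_one ht.ne']; ring_nf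
        calc K * ‖y - p‖ ^ (μ + 1 - 2) ≤ K * (1 / 2 * t) ^ (μ - 1) := by gcongr
          _ = (K * (1 / 2) ^ (μ - 1) * t) * t ^ (μ - 2) := by
              rw [Real.mul_rpow (by norm_num) ht.le, e5]; ring
          _ ≤ _ := by gcongr
      have e6 : c / 2 * t ^ (μ - 2) ≤ ‖h y‖ := by
        have hlx := hlow x hxn
        have : ‖t ^ (μ - 2) * iteratedFDeriv ℝ 2 F x ![n, n]‖ ≤
            ‖h y‖ + ‖iteratedFDeriv ℝ 2 R y ![n, n]‖ := by
          rw [e1]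
          simpa using norm_sub_le (t ^ (μ - 2) * iteratedFDeriv ℝ 2 F x ![n, n] +
            iteratedFDeriv ℝ 2 R y ![n, n]) (iteratedFDeriv ℝ 2 R y ![n, n])
        have hpow : 0 < t ^ (μ - 2) := Real.rpow_pos_of_pos ht _
        rw [norm_mul, Real.norm_of_nonneg hpow.le] at this
        nlinarith
      have e7 : 0 ≤ c / 2 * t ^ (μ - 2) := by positivity
      rw [← sq_abs (h y)]
      exact pow_le_pow_left₀ e7 e6 2
    have hvol : volume.real (Metric.ball (p + t • n) (κ' * t)) = (κ' * t) ^ 2 * V := by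
      have hκt : 0 ≤ κ' * t := by positivity
      have := Measure.addHaar_ball (volume : Measure Plane) (p + t • n) hκt
      rw [measureReal_def, this, ENNReal.toReal_mul, ENNReal.toReal_ofReal (by positivity)]
      simp [hV, measureReal_def]
    calc (c / 2) ^ 2 * κ' ^ 2 * V * t ^ (2 * (μ - 1))
        = (c / 2 * t ^ (μ - 2)) ^ 2 * volume.real (Metric.ball (p + t • n) (κ' * t)) := by
          rw [hvol]
          have : t ^ (2 * (μ - 1)) = (t ^ (μ - 2)) ^ 2 * t ^ 2 := by
            rw [← Real.rpow_natCast, ← Real.rpow_natCast, ← Real.rpow_mul ht.le,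
              ← Real.rpow_add ht]
            congr 1; push_cast; ring
          rw [this]; ring
      _ ≤ ∫ y in Metric.ball (p + t • n) (κ' * t), h y ^ 2 :=
          setIntegral_ge_of_const_le_real measurableSet_ball measure_ball_lt_top.ne hpt
            (hint.mono_set hsub)
      _ ≤ _ := setIntegral_mono_set hint (.of_forall fun y => sq_nonneg _) hsub.eventuallyLE
  have hlim : Tendsto (fun t : ℝ => (c / 2) ^ 2 * κ' ^ 2 * V * t ^ (2 * (μ - 1))) (𝓝[>] 0) atTop :=
    (tendsto_rpow_neg_nhdsGT_zero (by linarith)).const_mul_atTop (by positivity)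
  have hKt : Tendsto (fun t : ℝ => K * (1 / 2) ^ (μ - 1) * t) (𝓝[>] 0) (𝓝 0) := by
    have : Continuous fun t : ℝ => K * (1 / 2) ^ (μ - 1) * t := by fun_prop
    simpa using (this.tendsto 0).mono_left nhdsWithin_le_nhds
  have hpos : ∀ᶠ t : ℝ in 𝓝[>] 0, 0 < t := self_mem_nhdsWithin
  have hsmall : ∀ {r : ℝ}, 0 < r → ∀ᶠ t : ℝ in 𝓝[>] 0, t < r := fun hr =>
    (gt_mem_nhds hr).filter_mono nhdsWithin_le_nhds
  obtain ⟨t, ht0, h1, h2, h3, h4⟩ := (hpos.and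
    ((hlim.eventually (eventually_gt_atTop (∫ y in G, h y ^ 2))).and
      ((hKt.eventually (gt_mem_nhds (half_pos hc))).and
        ((hsmall hδ).and (hsmall one_half_pos))))).exists
  exact absurd (main t ht0 h3 (le_of_lt h4) h2.le) (not_le.2 h1)

/-! ### Homogeneous harmonic functions in a half-plane -/

/-- The Laplacian may be computed in any orthonormal basis, in particular in the image under `L` of
the standard one. -/
theorem laplacian_comp_linearIsometryEquiv (L : Plane ≃ₗᵢ[ℝ] ℂ) (f : ℂ → ℝ) (x : Plane) :
    Laplacian.laplacian (f ∘ L) x = Laplacian.laplacian f (L x) := by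
  let b := EuclideanSpace.basisFun (Fin 2) ℝ
  rw [InnerProductSpace.laplacian_eq_iteratedFDeriv_orthonormalBasis _ b,
    InnerProductSpace.laplacian_eq_iteratedFDeriv_orthonormalBasis _ (b.map L)]
  refine Finset.sum_congr rfl fun i _ => ?_
  have h := L.toContinuousLinearEquiv.iteratedFDerivWithin_comp_right f uniqueDiffOn_univ
    (x := x) (mem_univ _) 2
  simp only [preimage_univ, iteratedFDerivWithin_univ] at h
  have h' : iteratedFDeriv ℝ 2 (f ∘ L) x = _ := h
  rw [h']
  simp only [ContinuousMultilinearMap.compContinuousLinearMap_apply]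
  congr 1
  ext j
  fin_cases j <;> simp

/-- The function `Re (κ z^μ)` in the right half-plane, continued smoothly to the plane without the
origin. -/
noncomputable def sectorial (κ : ℂ) (μ : ℝ) (z : ℂ) : ℝ :=
  Real.smoothTransition (1 + 2 * (z.re / ‖z‖)) * (κ * z ^ (μ : ℂ)).re

theorem sectorial_of_re_nonneg (κ : ℂ) (μ : ℝ) {z : ℂ} (hz : 0 ≤ z.re) :
    sectorial κ μ z = (κ * z ^ (μ : ℂ)).re := by
  rw [sectorial, Real.smoothTransition.one_of_one_le, one_mul]
  have : 0 ≤ z.re / ‖z‖ := by positivity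
  linarith

/-- The only danger is the branch cut along the negative real axis, and the angular factor vanishes
identically near it: it is zero wherever cos θ ≤ -1/2. -/
theorem contDiffOn_sectorial (κ : ℂ) (μ : ℝ) : ContDiffOn ℝ ∞ (sectorial κ μ) {0}ᶜ := by
  intro z hz
  refine ContDiffAt.contDiffWithinAt ?_
  have hz0 : z ≠ 0 := hz
  have hn : ContDiffAt ℝ ∞ (fun z : ℂ => z.re / ‖z‖) z :=
    (Complex.reCLM.contDiff.contDiffAt).div (contDiffAt_norm ℝ hz0) (norm_ne_zero_iff.2 hz0)
  by_cases hs : z ∈ Complex.slitPlane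
  · refine ContDiffAt.mul ?_ ?_
    · exact Real.smoothTransition.contDiff.contDiffAt.comp z
        (contDiffAt_const.add (contDiffAt_const.mul hn))
    · have h1 : AnalyticAt ℂ (fun z : ℂ => κ * z ^ (μ : ℂ)) z :=
        analyticAt_const.mul (analyticAt_id.cpow analyticAt_const hs)
      exact Complex.reCLM.contDiff.contDiffAt.comp z (h1.contDiffAt.restrict_scalars ℝ)
  · have hre : z.re < 0 := by
      rw [Complex.mem_slitPlane_iff, not_or, not_lt, not_ne_iff] at hs
      exact lt_of_le_of_ne hs.1 fun e => hz0 (Complex.ext e hs.2)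
    have hv : z.re / ‖z‖ = -1 := by
      rw [Complex.mem_slitPlane_iff, not_or, not_lt, not_ne_iff] at hs
      have : ‖z‖ = -z.re := by
        rw [← Complex.abs_re_eq_norm.2 hs.2, abs_of_neg hre]
      rw [this, div_neg, div_self hre.ne]
    have : sectorial κ μ =ᶠ[𝓝 z] fun _ => 0 := by
      filter_upwards [hn.continuousAt.eventually
        (gt_mem_nhds (show z.re / ‖z‖ < -(1 / 2) by rw [hv]; norm_num))] with w hw
      rw [sectorial, Real.smoothTransition.zero_of_nonpos (by linarith), zero_mul]
    exact contDiffAt_const.congr_of_eventuallyEq this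

theorem re_mul_cpow (κ : ℂ) (μ : ℝ) (z : ℂ) : (κ * z ^ (μ : ℂ)).re =
    ‖z‖ ^ μ * (κ.re * Real.cos (z.arg * μ) - κ.im * Real.sin (z.arg * μ)) := by
  rw [Complex.cpow_ofReal]
  simp only [Complex.mul_re, Complex.mul_im, Complex.add_re, Complex.add_im, Complex.ofReal_re,
    Complex.ofReal_im, Complex.I_re, Complex.I_im]
  ring

theorem sectorial_smul (κ : ℂ) (μ : ℝ) {t : ℝ} (ht : 0 < t) (z : ℂ) :
    sectorial κ μ (t • z) = t ^ μ * sectorial κ μ z := by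
  have h1 : (t • z).re / ‖t • z‖ = z.re / ‖z‖ := by
    rw [norm_smul, Real.norm_of_nonneg ht.le, Complex.smul_re, smul_eq_mul,
      mul_div_mul_left _ _ ht.ne']
  have h2 : (t • z).arg = z.arg := by rw [Complex.real_smul, Complex.arg_real_mul _ ht]
  rw [sectorial, sectorial, h1, re_mul_cpow, re_mul_cpow, h2, norm_smul,
    Real.norm_of_nonneg ht.le, Real.mul_rpow ht.le (norm_nonneg _)]
  ring

/-- In the open half-plane the angular factor is 1, leaving the real part of a holomorphic function.
-/
theorem laplacian_sectorial (κ : ℂ) (μ : ℝ) {z : ℂ} (hz : 0 < z.re) :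
    Laplacian.laplacian (sectorial κ μ) z = 0 := by
  have he : sectorial κ μ =ᶠ[𝓝 z] fun z => (κ * z ^ (μ : ℂ)).re := by
    filter_upwards [Complex.continuous_re.continuousAt.eventually (lt_mem_nhds hz)] with w hw
    exact sectorial_of_re_nonneg κ μ hw.le
  have h1 : AnalyticAt ℂ (fun z : ℂ => κ * z ^ (μ : ℂ)) z :=
    analyticAt_const.mul (analyticAt_id.cpow analyticAt_const (Or.inl hz))
  rw [(InnerProductSpace.laplacian_congr_nhds he).eq_of_nhds]
  exact h1.harmonicAt_re.2.eq_of_nhds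

theorem sectorial_ofReal (κ : ℂ) (μ : ℝ) {r : ℝ} (hr : 0 ≤ r) :
    sectorial κ μ r = r ^ μ * κ.re := by
  rw [sectorial_of_re_nonneg _ _ (by simpa using hr), re_mul_cpow, Complex.arg_ofReal_of_nonneg hr]
  simp [abs_of_nonneg hr]

theorem sectorial_mul_I (κ : ℂ) (μ : ℝ) {r : ℝ} (hr : 0 < r) :
    sectorial κ μ (r * Complex.I) = r ^ μ *
      (κ.re * Real.cos (Real.pi / 2 * μ) - κ.im * Real.sin (Real.pi / 2 * μ)) := by
  rw [sectorial_of_re_nonneg _ _ (by simp), re_mul_cpow, Complex.arg_real_mul _ hr,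
    Complex.arg_I]
  simp [abs_of_pos hr]

theorem sectorial_neg_mul_I (κ : ℂ) (μ : ℝ) {r : ℝ} (hr : 0 < r) :
    sectorial κ μ (-(r * Complex.I)) = r ^ μ *
      (κ.re * Real.cos (Real.pi / 2 * μ) + κ.im * Real.sin (Real.pi / 2 * μ)) := by
  rw [← mul_neg, sectorial_of_re_nonneg _ _ (by simp), re_mul_cpow, Complex.arg_real_mul _ hr,
    Complex.arg_neg_I]
  simp [abs_of_pos hr]

/-- The second radial derivative of a homogeneous function. -/
theorem iteratedFDeriv_two_of_homogeneous {F : Plane → ℝ} {μ : ℝ}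
    (hF : ContDiffOn ℝ ∞ F {0}ᶜ) (hom : ∀ t : ℝ, 0 < t → ∀ x, F (t • x) = t ^ μ * F x)
    {n : Plane} (hn : n ≠ 0) :
    iteratedFDeriv ℝ 2 F n ![n, n] = μ * (μ - 1) * F n := by
  have ho : IsOpen ({0}ᶜ : Set Plane) := isOpen_compl_singleton
  have hline : ∀ t : ℝ, HasDerivAt (fun t : ℝ => t • n) n t := fun t => by
    simpa using (hasDerivAt_id t).smul_const n
  -- Euler's relation: t ↦ F(tn) = t^μ F(n) is differentiated along the ray; a second
  -- differentiation at t = 1 gives the claim.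
  have h1 : ∀ t : ℝ, 0 < t → fderiv ℝ F (t • n) n = μ * t ^ (μ - 1) * F n := by
    intro t ht
    have hd : DifferentiableAt ℝ F (t • n) :=
      (hF.contDiffAt (ho.mem_nhds (smul_ne_zero ht.ne' hn))).differentiableAt (by simp)
    have e1 := hd.hasFDerivAt.comp_hasDerivAt t (hline t)
    have e2 : HasDerivAt (F ∘ fun t : ℝ => t • n) (μ * t ^ (μ - 1) * F n) t := by
      refine ((Real.hasDerivAt_rpow_const (p := μ) (Or.inl ht.ne')).mul_const
        (F n)).congr_of_eventuallyEq ?_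
      filter_upwards [lt_mem_nhds ht] with s hs
      exact hom s hs n
    exact e1.unique e2
  have hd : DifferentiableAt ℝ (fderiv ℝ F) ((1 : ℝ) • n) := by
    rw [one_smul]
    exact ((hF.contDiffAt (ho.mem_nhds hn)).fderiv_right (m := 1) (by norm_cast)).differentiableAt
      (by simp)
  have e0 : HasDerivAt (fun t : ℝ => fderiv ℝ F (t • n)) (fderiv ℝ (fderiv ℝ F) ((1 : ℝ) • n) n)
      1 := hd.hasFDerivAt.comp_hasDerivAt 1 (hline 1)
  have e1 : HasDerivAt (fun t : ℝ => fderiv ℝ F (t • n) n)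
      (fderiv ℝ (fderiv ℝ F) ((1 : ℝ) • n) n n) 1 := by
    simpa using e0.clm_apply (hasDerivAt_const (1 : ℝ) n)
  have e2 : HasDerivAt (fun t : ℝ => fderiv ℝ F (t • n) n) (μ * (μ - 1) * F n) 1 := by
    have := ((Real.hasDerivAt_rpow_const (p := μ - 1) (Or.inl (one_ne_zero' ℝ))).const_mul
      μ).mul_const (F n)
    rw [Real.one_rpow, mul_one] at this
    refine this.congr_of_eventuallyEq ?_
    filter_upwards [lt_mem_nhds one_pos] with s hs
    exact h1 s hs
  have := e1.unique e2
  rw [one_smul] at this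
  rw [iteratedFDeriv_two_apply]
  exact this

/-! ### Local coordinates at an end point -/

/-- An isometry of the plane with `ℂ` which takes a given unit vector to `1` and preserves
orientation. -/
theorem exists_linearIsometryEquiv_complex {n : Plane} (hn : ‖n‖ = 1) :
    ∃ L : Plane ≃ₗᵢ[ℝ] ℂ, (∀ y, (L y).re = inner ℝ n y) ∧
      ∀ y, L (quarterTurn y) = Complex.I * L y := by
  have hn2 : n 0 ^ 2 + n 1 ^ 2 = 1 := by
    have := EuclideanSpace.norm_sq_eq n
    rw [hn, Fin.sum_univ_two] at this
    simpa using this.symm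
  -- The complex conjugate of n, so that multiplication by the unit number w takes n to 1.
  let w : ℂ := ⟨n 0, -n 1⟩
  have hw : ‖w‖ = 1 := by
    have : ‖w‖ ^ 2 = 1 := by
      rw [Complex.sq_norm, Complex.normSq_mk]; linarith
    nlinarith [norm_nonneg w]
  let L : Plane ≃ₗᵢ[ℝ] ℂ := Complex.orthonormalBasisOneI.repr.symm.trans
    (rotation ⟨w, mem_sphere_zero_iff_norm.2 hw⟩)
  have hL : ∀ y, L y = w * (y 0 + y 1 * Complex.I) := by
    intro y
    change w * Complex.orthonormalBasisOneI.repr.symm y = _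
    rw [Complex.orthonormalBasisOneI_repr_symm_apply]
  refine ⟨L, fun y => ?_, fun y => ?_⟩
  · rw [hL, PiLp.inner_apply, Fin.sum_univ_two]
    simp [w]
    ring
  · rw [hL, hL]
    apply Complex.ext
    · simp [quarterTurn, w]; ring
    · simp [quarterTurn, w]

theorem inner_eq_zero_of_mem_frontier {G : Set Plane} (hG : IsOpen G) {p n y : Plane} {δ : ℝ}
    (hflat : ∀ y ∈ Metric.ball p δ, (y ∈ G ↔ 0 < inner ℝ n (y - p)))
    (hy : y ∈ Metric.ball p δ) (hf : y ∈ frontier G) : inner ℝ n (y - p) = 0 := by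
  rw [hG.frontier_eq] at hf
  have h1 : ¬ 0 < inner ℝ n (y - p) := fun h => hf.2 ((hflat y hy).2 h)
  by_contra h0
  have hneg : inner ℝ n (y - p) < 0 := lt_of_le_of_ne (not_lt.1 h1) h0
  have hc : Continuous fun z : Plane => (inner ℝ n (z - p) : ℝ) := by fun_prop
  obtain ⟨z, ⟨hz1, hz2⟩, hz⟩ := mem_closure_iff_nhds.1 hf.1 _
    (inter_mem (Metric.isOpen_ball.mem_nhds hy) (hc.continuousAt.eventually (gt_mem_nhds hneg)))
  exact absurd ((hflat z hz1).1 hz) (not_lt.2 (le_of_lt hz2))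

theorem mem_frontier_of_inner_eq_zero {G : Set Plane} (hG : IsOpen G) {p n y : Plane} {δ : ℝ}
    (hn : ‖n‖ = 1) (hflat : ∀ y ∈ Metric.ball p δ, (y ∈ G ↔ 0 < inner ℝ n (y - p)))
    (hy : y ∈ Metric.ball p δ) (h0 : inner ℝ n (y - p) = 0) : y ∈ frontier G := by
  rw [hG.frontier_eq]
  refine ⟨?_, fun h => ?_⟩
  · have hc : Tendsto (fun t : ℝ => y + t • n) (𝓝[>] 0) (𝓝 y) := by
      have : Continuous fun t : ℝ => y + t • n := by fun_prop
      simpa using (this.tendsto 0).mono_left nhdsWithin_le_nhds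
    refine mem_closure_of_tendsto hc ?_
    filter_upwards [hc.eventually (Metric.isOpen_ball.mem_nhds hy), self_mem_nhdsWithin]
      with t ht ht0
    refine (hflat _ ht).2 ?_
    rw [add_sub_right_comm, inner_add_right, h0, inner_smul_right, real_inner_self_eq_norm_sq, hn]
    simpa using ht0
  · have := (hflat y hy).1 h
    linarith

/-- Near `p`, a boundary curve which is rotated about `p` into the domain through a right angle
lies on a ray, and its image lies on the inner normal. -/
theorem exists_sign_of_rotatesNear {G Γ : Set Plane} (hG : IsOpen G) (hΓ : Γ ⊆ frontier G)
    {T : Plane → Plane} (hT : MapsTo T Γ G) {p n : Plane} (hr : RotatesNear T Γ p)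
    {L : Plane ≃ₗᵢ[ℝ] ℂ} (hLn : ∀ y, (L y).re = inner ℝ n y)
    (hLq : ∀ y, L (quarterTurn y) = Complex.I * L y) {δ : ℝ} (hδ : 0 < δ)
    (hflat : ∀ y ∈ Metric.ball p δ, (y ∈ G ↔ 0 < inner ℝ n (y - p))) :
    ∃ s : ℝ, (s = 1 ∨ s = -1) ∧ ∀ᶠ y in 𝓝[Γ] p,
      L (y - p) = s * ‖y - p‖ * Complex.I ∧ L (T y - p) = ‖y - p‖ := by
  obtain ⟨σ, hσ, hσT⟩ : ∃ σ : ℝ, (σ = 1 ∨ σ = -1) ∧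
      ∀ᶠ y in 𝓝[Γ] p, T y = p + σ • quarterTurn (y - p) := by
    rcases hr.2 with h | h
    · exact ⟨1, Or.inl rfl, by simpa using h⟩
    · exact ⟨-1, Or.inr rfl, by simpa [sub_eq_add_neg] using h⟩
  refine ⟨-σ, by rcases hσ with h | h <;> simp [h], ?_⟩
  filter_upwards [hσT, self_mem_nhdsWithin, mem_nhdsWithin_of_mem_nhds (Metric.ball_mem_nhds p hδ)]
    with y hy hyΓ hyδ
  have hre : (L (y - p)).re = 0 := by
    rw [hLn]; exact inner_eq_zero_of_mem_frontier hG hflat hyδ (hΓ hyΓ)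
  have hLT : L (T y - p) = σ * Complex.I * L (y - p) := by
    rw [hy, add_sub_cancel_left, map_smul, hLq, Complex.real_smul, mul_assoc]
  have hnorm : ‖T y - p‖ = ‖y - p‖ := by
    rw [← L.norm_map (T y - p), hLT, ← L.norm_map (y - p)]
    rcases hσ with h | h <;> simp [h]
  -- The image lies in `G`, so its real part -σ Im L(y - p) is positive. This selects the half of
  -- the imaginary axis that contains y.
  have hpos : 0 < (L (T y - p)).re := by
    rw [hLn]
    refine (hflat _ ?_).1 (hT hyΓ)
    rw [Metric.mem_ball, dist_eq_norm] at hyδ ⊢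
    rwa [hnorm]
  have him : (L (T y - p)).re = -σ * (L (y - p)).im := by rw [hLT]; simp
  have habs : ‖y - p‖ = |(L (y - p)).im| := by
    rw [← L.norm_map, Complex.abs_im_eq_norm.2 hre]
  have hb : (L (y - p)).im = -σ * ‖y - p‖ := by
    rw [habs]
    rcases hσ with h | h
    · rw [him, h] at hpos; rw [h, abs_of_neg (by linarith)]; ring
    · rw [him, h] at hpos; rw [h, abs_of_pos (by linarith)]; ring
  have e1 : L (y - p) = ((-σ : ℝ) : ℂ) * ‖y - p‖ * Complex.I := by
    apply Complex.ext
    · simp [-map_sub, hre]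
    · simp [-map_sub, hb]
  refine ⟨e1, ?_⟩
  rw [hLT, e1]
  rcases hσ with h | h <;> rw [h] <;> push_cast <;> linear_combination (-(‖y - p‖ : ℂ)) * Complex.I_sq

/-- Coordinates about an end point `p` in which the domain is the right half-plane, the first curve
is the upper, and the second curve is the lower half of the imaginary axis. -/
theorem exists_local_coordinates {G Γ₁ Γ₂ : Set Plane} (hG : IsOpen G) {p q : Plane}
    (hpq : p ≠ q) (hfr : frontier G = Γ₁ ∪ Γ₂ ∪ {p, q}) (hflat : IsFlatNear G p)
    {T₁ T₂ : Plane → Plane} (h₁ : MapsTo T₁ Γ₁ G) (h₂ : MapsTo T₂ Γ₂ G)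
    (r₁ : RotatesNear T₁ Γ₁ p) (r₂ : RotatesNear T₂ Γ₂ p) :
    ∃ (L : Plane ≃ₗᵢ[ℝ] ℂ) (δ : ℝ), 0 < δ ∧
      (∀ y, ‖y - p‖ < δ → (y ∈ G ↔ 0 < (L (y - p)).re)) ∧
      (∀ y ∈ Γ₁, ‖y - p‖ < δ → L (y - p) = ‖y - p‖ * Complex.I ∧ L (T₁ y - p) = ‖y - p‖) ∧
      (∀ y ∈ Γ₂, ‖y - p‖ < δ → L (y - p) = -(‖y - p‖ * Complex.I) ∧ L (T₂ y - p) = ‖y - p‖) := by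
  obtain ⟨n, hn, hfl⟩ := hflat
  obtain ⟨δ₀, hδ₀, hfl⟩ := Metric.eventually_nhds_iff_ball.1 hfl
  obtain ⟨L, hLn, hLq⟩ := exists_linearIsometryEquiv_complex hn
  have hs₁ : Γ₁ ⊆ frontier G := by
    rw [hfr]; exact subset_union_left.trans subset_union_left
  have hs₂ : Γ₂ ⊆ frontier G := by
    rw [hfr]; exact subset_union_right.trans subset_union_left
  obtain ⟨s₁, hs₁', e₁⟩ := exists_sign_of_rotatesNear hG hs₁ h₁ r₁ hLn hLq hδ₀ hfl
  obtain ⟨s₂, hs₂', e₂⟩ := exists_sign_of_rotatesNear hG hs₂ h₂ r₂ hLn hLq hδ₀ hfl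
  rw [eventually_nhdsWithin_iff, Metric.eventually_nhds_iff_ball] at e₁ e₂
  obtain ⟨δ₁, hδ₁, e₁⟩ := e₁
  obtain ⟨δ₂, hδ₂, e₂⟩ := e₂
  obtain ⟨δ, hδ, hδ0, hδ1, hδ2, hδq⟩ : ∃ δ, 0 < δ ∧ δ ≤ δ₀ ∧ δ ≤ δ₁ ∧ δ ≤ δ₂ ∧ δ ≤ ‖q - p‖ := by
    have : 0 < ‖q - p‖ := norm_sub_pos_of_ne hpq.symm
    exact ⟨min (min δ₀ δ₁) (min δ₂ ‖q - p‖), by positivity, by simp, by simp, by simp, by simp⟩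
  have mb : ∀ {y : Plane} {ρ : ℝ}, δ ≤ ρ → ‖y - p‖ < δ → y ∈ Metric.ball p ρ := fun h hy => by
    rw [Metric.mem_ball, dist_eq_norm]; exact hy.trans_le h
  -- If both curves lay on the same ray, the point at distance δ/2 on the opposite ray would still
  -- be a boundary point, yet on neither curve and different from p and q; the choice δ ≤ ‖q - p‖
  -- excludes q.
  have hopp : s₂ = -s₁ := by
    by_contra hne
    have hss : s₂ = s₁ := by
      rcases hs₁' with h | h <;> rcases hs₂' with h' | h' <;> simp_all
    have hs1a : |s₁| = 1 := by rcases hs₁' with h | h <;> simp [h]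
    set y : Plane := p + L.symm (((-s₁ * (δ / 2) : ℝ) : ℂ) * Complex.I) with hy
    have hLy : L (y - p) = ((-s₁ * (δ / 2) : ℝ) : ℂ) * Complex.I := by
      rw [hy, add_sub_cancel_left, L.apply_symm_apply]
    have hny : ‖y - p‖ = δ / 2 := by
      rw [← L.norm_map, hLy, norm_mul, Complex.norm_I, mul_one, Complex.norm_real,
        Real.norm_eq_abs, abs_mul, abs_neg, hs1a, one_mul, abs_of_pos (by positivity)]
    have hlt : ‖y - p‖ < δ := by rw [hny]; linarith
    have hyf : y ∈ frontier G := mem_frontier_of_inner_eq_zero hG hn hfl (mb hδ0 hlt) (by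
      rw [← hLn, hLy]; simp)
    have hcon : ¬ L (y - p) = s₁ * ‖y - p‖ * Complex.I := by
      intro h
      rw [hLy, hny] at h
      have := congrArg Complex.im h
      simp only [Complex.mul_im, Complex.mul_re, Complex.ofReal_re, Complex.ofReal_im,
        Complex.I_re, Complex.I_im] at this
      rcases hs₁' with h' | h' <;> rw [h'] at this <;> linarith
    rw [hfr] at hyf
    rcases hyf with (hyf | hyf) | hyf
    · exact hcon (e₁ y (mb hδ1 hlt) hyf).1
    · exact hcon (hss ▸ (e₂ y (mb hδ2 hlt) hyf).1)
    · rcases hyf with h | h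
      · rw [h, sub_self, norm_zero] at hny; linarith
      · rw [mem_singleton_iff.1 h] at hlt; linarith
  have hG' : ∀ y, ‖y - p‖ < δ → (y ∈ G ↔ 0 < (L (y - p)).re) := fun y hy => by
    rw [hLn]; exact hfl y (mb hδ0 hy)
  rcases hs₁' with h | h
  · rw [hopp, h] at e₂
    rw [h] at e₁
    refine ⟨L, δ, hδ, hG', fun y hy hyδ => ?_, fun y hy hyδ => ?_⟩
    · simpa using e₁ y (mb hδ1 hyδ) hy
    · simpa using e₂ y (mb hδ2 hyδ) hy
  · rw [hopp, h] at e₂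
    rw [h] at e₁
    -- Conjugation exchanges the two halves of the imaginary axis and fixes real parts, hence also
    -- the half-plane and the images on the positive axis.
    refine ⟨L.trans Complex.conjLIE, δ, hδ, fun y hy => ?_, fun y hy hyδ => ?_, fun y hy hyδ => ?_⟩
    · simpa using hG' y hy
    · have := e₁ y (mb hδ1 hyδ) hy
      simp [this.1, this.2]
    · have := e₂ y (mb hδ2 hyδ) hy
      simp [this.1, this.2]

/-! ### The transformations away from the end point -/

theorem isCompact_closure_openCurve {γ : ℝ → Plane} (hγ : Continuous γ) :
    IsCompact (closure (openCurve γ)) := by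
  have hK : IsCompact (γ '' Icc 0 1) := isCompact_Icc.image hγ
  exact hK.of_isClosed_subset isClosed_closure
    (closure_minimal (image_mono Ioo_subset_Icc_self) hK.isClosed)

theorem mem_closure_openCurve {γ : ℝ → Plane} (hγ : Continuous γ) {t : ℝ} (ht : t ∈ Icc (0 : ℝ) 1) :
    γ t ∈ closure (openCurve γ) := by
  rw [← closure_Ioo zero_ne_one] at ht
  exact image_closure_subset_closure_image hγ (mem_image_of_mem γ ht)

/-- A diffeomorphism fixing `p` keeps points away from `p` if they are away from `p`. -/
theorem IsDiffeoNear.exists_le_norm_sub {T : Plane → Plane} {γ : ℝ → Plane} (hγ : Continuous γ)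
    (hT : IsDiffeoNear T (closure (openCurve γ))) {p : Plane} (hp : p ∈ closure (openCurve γ))
    (hTp : T p = p) {δ : ℝ} (hδ : 0 < δ) :
    ∃ ε, 0 < ε ∧ ∀ y ∈ openCurve γ, δ ≤ ‖y - p‖ → ε ≤ ‖T y - p‖ := by
  obtain ⟨O, hO, hsO, -, hTO, T', -, hT'⟩ := hT
  have hK : IsCompact (closure (openCurve γ) \ Metric.ball p δ) :=
    (isCompact_closure_openCurve hγ).diff Metric.isOpen_ball
  have hK' := hK.image_of_continuousOn (hTO.continuousOn.mono (sdiff_subset.trans hsO))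
  -- The left inverse makes T injective near the closed curve, so only p itself is mapped to p.
  have hpK : p ∉ T '' (closure (openCurve γ) \ Metric.ball p δ) := by
    rintro ⟨y, hy, hTy⟩
    have e₁ := hT' y (hsO hy.1)
    have e₂ := hT' p (hsO hp)
    rw [hTy] at e₁
    rw [hTp] at e₂
    exact hy.2 (e₁.symm.trans e₂ ▸ Metric.mem_ball_self hδ)
  obtain ⟨ε, hε, hεb⟩ := Metric.mem_nhds_iff.1 (hK'.isClosed.isOpen_compl.mem_nhds hpK)
  refine ⟨ε, hε, fun y hy hyδ => not_lt.1 fun hlt => ?_⟩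
  refine hεb (show T y ∈ Metric.ball p ε by rwa [Metric.mem_ball, dist_eq_norm])
    ⟨y, ⟨subset_closure hy, ?_⟩, rfl⟩
  rw [Metric.mem_ball, dist_eq_norm, not_lt]
  exact hyδ

theorem exists_le_norm_sub_of_notMem_closure {T : Plane → Plane} {Γ : Set Plane} {p : Plane}
    (hp : p ∉ closure (T '' Γ)) : ∃ ε, 0 < ε ∧ ∀ y ∈ Γ, ε ≤ ‖T y - p‖ := by
  obtain ⟨ε, hε, hεb⟩ := Metric.mem_nhds_iff.1 (isClosed_closure.isOpen_compl.mem_nhds hp)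
  refine ⟨ε, hε, fun y hy => not_lt.1 fun hlt => ?_⟩
  exact hεb (show T y ∈ Metric.ball p ε by rwa [Metric.mem_ball, dist_eq_norm])
    (subset_closure (mem_image_of_mem T hy))

theorem IsDiffeoNear.continuousOn_comp {T : Plane → Plane} {γ : ℝ → Plane} (hγ : Continuous γ)
    (hT : IsDiffeoNear T (closure (openCurve γ))) : ContinuousOn (T ∘ γ) (Ioo 0 1) := by
  obtain ⟨O, -, hsO, -, hTO, -⟩ := hT
  exact (hTO.continuousOn.mono hsO).comp hγ.continuousOn
    fun t ht => subset_closure (mem_image_of_mem γ ht)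

/-! ### Cutoff, auxiliary homogeneous function and exponent -/

/-- A smooth radial function which equals `1` near `p` and vanishes outside the disc of radius `ε`
about `p`. -/
noncomputable def radialCutoff (p : Plane) (ε : ℝ) (y : Plane) : ℝ :=
  Real.smoothTransition (2 - 2 / ε ^ 2 * ‖y - p‖ ^ 2)

theorem contDiff_radialCutoff (p : Plane) (ε : ℝ) : ContDiff ℝ ∞ (radialCutoff p ε) :=
  Real.smoothTransition.contDiff.comp (contDiff_const.sub (contDiff_const.mul
    ((contDiff_id.sub contDiff_const).norm_sq ℝ)))

theorem radialCutoff_self (p : Plane) (ε : ℝ) : radialCutoff p ε p = 1 :=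
  Real.smoothTransition.one_of_one_le (by simp)

theorem radialCutoff_of_ge {p y : Plane} {ε : ℝ} (hε : 0 < ε) (h : ε ≤ ‖y - p‖) :
    radialCutoff p ε y = 0 := by
  refine Real.smoothTransition.zero_of_nonpos ?_
  have h1 : ε ^ 2 ≤ ‖y - p‖ ^ 2 := by gcongr
  have h2 : 2 / ε ^ 2 * ε ^ 2 ≤ 2 / ε ^ 2 * ‖y - p‖ ^ 2 := by gcongr
  rw [div_mul_cancel₀ _ (by positivity)] at h2
  linarith

/-- Lets the cutoff be factored out of the nonlocal conditions, where a point and its rotated image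
are equidistant from p. -/
theorem radialCutoff_congr {p y z : Plane} (ε : ℝ) (h : ‖y - p‖ = ‖z - p‖) :
    radialCutoff p ε y = radialCutoff p ε z := by
  rw [radialCutoff, radialCutoff, h]

/-- A homogeneous function of degree `μ` which equals `|z|^μ` on the imaginary axis and vanishes on
the real axis. -/
noncomputable def imPower (μ : ℝ) (z : ℂ) : ℝ := z.im ^ 2 * ‖z‖ ^ (μ - 2)

theorem contDiffOn_imPower (μ : ℝ) : ContDiffOn ℝ ∞ (imPower μ) {0}ᶜ := by
  intro z hz
  refine ContDiffAt.contDiffWithinAt ?_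
  exact (Complex.imCLM.contDiff.contDiffAt.pow 2).mul
    ((contDiffAt_norm ℝ hz).rpow_const_of_ne (norm_ne_zero_iff.2 hz))

theorem imPower_smul (μ : ℝ) {t : ℝ} (ht : 0 < t) (z : ℂ) :
    imPower μ (t • z) = t ^ μ * imPower μ z := by
  have h : t ^ μ = t ^ 2 * t ^ (μ - 2) := by
    rw [← Real.rpow_natCast, ← Real.rpow_add ht]; congr 1; push_cast; ring
  rw [imPower, imPower, norm_smul, Real.norm_of_nonneg ht.le, Real.mul_rpow ht.le (norm_nonneg _),
    Complex.smul_im, smul_eq_mul, h]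
  ring

theorem imPower_mul_I (μ : ℝ) {r : ℝ} (hr : 0 < r) : imPower μ (r * Complex.I) = r ^ μ := by
  have h : r ^ μ = r ^ 2 * r ^ (μ - 2) := by
    rw [← Real.rpow_natCast, ← Real.rpow_add hr]; congr 1; push_cast; ring
  rw [h]
  simp [imPower, abs_of_pos hr]

theorem imPower_neg_mul_I (μ : ℝ) {r : ℝ} (hr : 0 < r) :
    imPower μ (-(r * Complex.I)) = r ^ μ := by
  rw [← imPower_mul_I μ hr]
  simp [imPower]

theorem imPower_ofReal (μ r : ℝ) : imPower μ r = 0 := by simp [imPower]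

theorem contDiffOn_comp_isometry (L : Plane ≃ₗᵢ[ℝ] ℂ) {f : ℂ → ℝ} (hf : ContDiffOn ℝ ∞ f {0}ᶜ) :
    ContDiffOn ℝ ∞ (f ∘ L) {0}ᶜ :=
  hf.comp L.contDiff.contDiffOn fun x hx => by simpa using hx

theorem comp_isometry_smul (L : Plane ≃ₗᵢ[ℝ] ℂ) {f : ℂ → ℝ} {μ : ℝ}
    (hf : ∀ t : ℝ, 0 < t → ∀ z, f (t • z) = t ^ μ * f z) (t : ℝ) (ht : 0 < t) (x : Plane) :
    (f ∘ L) (t • x) = t ^ μ * (f ∘ L) x := by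
  rw [Function.comp_apply, map_smul, hf t ht, Function.comp_apply]

/-- The exponent of the singular solution. -/
theorem exists_exponent {β : ℝ} (hβ : β ∈ Ioo (-2 : ℝ) 0) :
    ∃ μ : ℝ, 0 < μ ∧ μ < 1 ∧ 2 * Real.cos (Real.pi / 2 * μ) = -β ∧
      0 < Real.sin (Real.pi / 2 * μ) := by
  have hπ := Real.pi_pos
  have h1 : 0 < Real.arccos (-β / 2) := Real.arccos_pos.2 (by linarith [hβ.1])
  have h2 : Real.arccos (-β / 2) < Real.pi / 2 :=
    Real.arccos_lt_pi_div_two.2 (by linarith [hβ.2])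
  have e : Real.pi / 2 * (2 / Real.pi * Real.arccos (-β / 2)) = Real.arccos (-β / 2) := by
    field_simp
  -- Since 0 < -β/2 < 1, the arccosine lies strictly between 0 and π/2; this is what puts μ in (0,
  -- 1).
  refine ⟨2 / Real.pi * Real.arccos (-β / 2), by positivity, ?_, ?_, ?_⟩
  · have : 2 / Real.pi * Real.arccos (-β / 2) < 2 / Real.pi * (Real.pi / 2) := by gcongr
    rwa [show 2 / Real.pi * (Real.pi / 2) = 1 by field_simp] at this
  · rw [e, Real.cos_arccos (by linarith [hβ.2]) (by linarith [hβ.1])]; ring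
  · rw [e]; exact Real.sin_pos_of_pos_of_lt_pi h1 (by linarith)

theorem abs_laplacian_le_of_hasOrder {p : Plane} {μ : ℝ} {u : Plane → ℝ} (h : HasOrder p μ u) :
    ∃ K, 0 ≤ K ∧ ∀ y, y ≠ p → ‖y - p‖ ≤ 1 →
      ‖Laplacian.laplacian u y‖ ≤ K * ‖y - p‖ ^ (μ - 2) := by
  obtain ⟨K, hK, hKb⟩ := h.abs_iteratedFDeriv_two_le
  refine ⟨2 * K, by positivity, fun y hy h1 => ?_⟩
  rw [InnerProductSpace.laplacian_eq_iteratedFDeriv_orthonormalBasis u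
    (EuclideanSpace.basisFun (Fin 2) ℝ)]
  beta_reduce
  rw [Fin.sum_univ_two]
  have hb := fun i => hKb y hy h1 (EuclideanSpace.basisFun (Fin 2) ℝ i) (by simp)
  linarith [norm_add_le (iteratedFDeriv ℝ 2 u y ![EuclideanSpace.basisFun (Fin 2) ℝ 0,
    EuclideanSpace.basisFun (Fin 2) ℝ 0]) (iteratedFDeriv ℝ 2 u y
      ![EuclideanSpace.basisFun (Fin 2) ℝ 1, EuclideanSpace.basisFun (Fin 2) ℝ 1]), hb 0, hb 1]

theorem continuousOn_laplacian {U : Set Plane} (hU : IsOpen U) {u : Plane → ℝ}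
    (hu : ContDiffOn ℝ ∞ u U) : ContinuousOn (Laplacian.laplacian u) U := by
  have h : ∀ j, ContinuousOn (pd j (pd j u)) U := fun j =>
    (contDiffOn_pd hU (contDiffOn_pd hU hu j) j).continuousOn
  exact ((h 0).add (h 1)).congr fun y hy =>
    laplacian_eq_sum_pd (hu.contDiffAt (hU.mem_nhds hy))

/-! ### The singular solution -/

section SingularSolution

variable (L : Plane ≃ₗᵢ[ℝ] ℂ) (p : Plane) (ε μ : ℝ) (C D : Plane → ℝ)

/-- The homogeneous leading term of the singular solution. -/
noncomputable def leadingTerm : Plane → ℝ := sectorial ⟨1, -C p⟩ μ ∘ L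

/-- The remainder of the singular solution, which is of order `μ + 1` at `p`. -/
noncomputable def remainderTerm (y : Plane) : ℝ :=
  (radialCutoff p ε y - 1) * leadingTerm L p μ C (y - p) +
    (radialCutoff p ε y * (C y - C p) * sectorial ⟨0, -1⟩ μ (L (y - p)) +
      radialCutoff p ε y * D y * imPower μ (L (y - p)))

/-- The solution with a power singularity at `p`. -/
noncomputable def singularSolution (y : Plane) : ℝ :=
  leadingTerm L p μ C (y - p) + remainderTerm L p ε μ C D y

theorem contDiffOn_leadingTerm : ContDiffOn ℝ ∞ (leadingTerm L p μ C) {0}ᶜ :=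
  contDiffOn_comp_isometry L (contDiffOn_sectorial _ _)

theorem leadingTerm_smul (t : ℝ) (ht : 0 < t) (x : Plane) :
    leadingTerm L p μ C (t • x) = t ^ μ * leadingTerm L p μ C x :=
  comp_isometry_smul L (fun _ ht => sectorial_smul _ _ ht) t ht x

theorem hasOrder_leadingTerm : HasOrder p μ (fun y => leadingTerm L p μ C (y - p)) :=
  HasOrder.of_homogeneous (contDiffOn_leadingTerm L p μ C) (leadingTerm_smul L p μ C) p

variable {C D}

/-- Each of the three summands is a smooth factor vanishing at p, of order 1, times a homogeneous
function of degree μ. For the first factor this uses that the cutoff equals 1 at p. -/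
theorem hasOrder_remainderTerm (hC : ContDiff ℝ ∞ C) (hD : ContDiff ℝ ∞ D) (hD0 : D p = 0) :
    HasOrder p (μ + 1) (remainderTerm L p ε μ C D) := by
  have hξ := contDiff_radialCutoff p ε
  have h₁ := (HasOrder.of_contDiff_of_eq_zero (p := p) (hξ.sub contDiff_const)
    (by rw [radialCutoff_self, sub_self])).mul (hasOrder_leadingTerm L p μ C)
  have h₂ := (HasOrder.of_contDiff_of_eq_zero (p := p) (hξ.mul (hC.sub (contDiff_const (c := C p))))
    (by rw [sub_self, mul_zero])).mul
    (HasOrder.of_homogeneous (contDiffOn_comp_isometry L (contDiffOn_sectorial ⟨0, -1⟩ μ))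
      (comp_isometry_smul L fun _ ht => sectorial_smul _ _ ht) p)
  have h₃ := (HasOrder.of_contDiff_of_eq_zero (p := p) (hξ.mul hD)
    (by rw [hD0, mul_zero])).mul
    (HasOrder.of_homogeneous (contDiffOn_comp_isometry L (contDiffOn_imPower μ))
      (comp_isometry_smul L fun _ ht => imPower_smul _ ht) p)
  rw [add_comm μ 1]
  exact h₁.add (h₂.add h₃)

theorem hasOrder_singularSolution (hC : ContDiff ℝ ∞ C) (hD : ContDiff ℝ ∞ D) (hD0 : D p = 0) :
    HasOrder p μ (singularSolution L p ε μ C D) :=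
  (hasOrder_leadingTerm L p μ C).add ((hasOrder_remainderTerm L p ε μ hC hD hD0).mono (by linarith))

/-- The splitting into leading term and remainder serves the estimates; this factored form serves
the boundary conditions and the support. -/
theorem singularSolution_eq (y : Plane) : singularSolution L p ε μ C D y =
    radialCutoff p ε y * (sectorial ⟨1, -C p⟩ μ (L (y - p)) +
      (C y - C p) * sectorial ⟨0, -1⟩ μ (L (y - p)) + D y * imPower μ (L (y - p))) := by
  simp only [singularSolution, remainderTerm, leadingTerm, Function.comp_apply]
  ring

variable {p ε μ} {y z : Plane}

theorem singularSolution_of_ge (hε : 0 < ε) (hy : ε ≤ ‖y - p‖) :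
    singularSolution L p ε μ C D y = 0 := by
  rw [singularSolution_eq, radialCutoff_of_ge hε hy, zero_mul]

theorem singularSolution_self (hμ : 0 < μ) : singularSolution L p ε μ C D p = 0 := by
  have h1 : ∀ κ : ℂ, sectorial κ μ 0 = 0 := fun κ => by
    simpa [Real.zero_rpow hμ.ne'] using sectorial_ofReal κ μ le_rfl
  have h2 : imPower μ 0 = 0 := by simp [imPower]
  rw [singularSolution_eq, sub_self, map_zero, h1, h1, h2]
  ring

theorem singularSolution_of_eq_norm (hy : L (y - p) = ‖y - p‖) :
    singularSolution L p ε μ C D y = radialCutoff p ε y * ‖y - p‖ ^ μ := by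
  rw [singularSolution_eq, hy, sectorial_ofReal _ _ (norm_nonneg _),
    sectorial_ofReal _ _ (norm_nonneg _), imPower_ofReal]
  ring

theorem singularSolution_of_eq_norm_mul_I (h0 : 0 < ‖y - p‖) (hy : L (y - p) = ‖y - p‖ * Complex.I) :
    singularSolution L p ε μ C D y = radialCutoff p ε y * ‖y - p‖ ^ μ *
      (Real.cos (Real.pi / 2 * μ) + C y * Real.sin (Real.pi / 2 * μ) + D y) := by
  rw [singularSolution_eq, hy, sectorial_mul_I _ _ h0, sectorial_mul_I _ _ h0, imPower_mul_I _ h0]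
  ring

theorem singularSolution_of_eq_neg_norm_mul_I (h0 : 0 < ‖y - p‖)
    (hy : L (y - p) = -(‖y - p‖ * Complex.I)) :
    singularSolution L p ε μ C D y = radialCutoff p ε y * ‖y - p‖ ^ μ *
      (Real.cos (Real.pi / 2 * μ) - C y * Real.sin (Real.pi / 2 * μ) + D y) := by
  rw [singularSolution_eq, hy, sectorial_neg_mul_I _ _ h0, sectorial_neg_mul_I _ _ h0,
    imPower_neg_mul_I _ h0]
  ring

theorem exists_norm_singularSolution_le (hε : 0 < ε) (hμ : 0 < μ) (hC : ContDiff ℝ ∞ C)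
    (hD : ContDiff ℝ ∞ D) (hD0 : D p = 0) :
    ∃ M, ∀ y, ‖singularSolution L p ε μ C D y‖ ≤ M := by
  have hc := (hasOrder_singularSolution L p ε μ hC hD hD0).continuous hμ (singularSolution_self L hμ)
  obtain ⟨M, hM⟩ := (isCompact_closedBall p ε).exists_bound_of_continuousOn hc.continuousOn
  refine ⟨M, fun y => ?_⟩
  by_cases hy : ‖y - p‖ ≤ ε
  · exact hM y (by simpa [dist_eq_norm] using hy)
  · rw [singularSolution_of_ge L hε (not_le.1 hy).le, norm_zero]
    exact (norm_nonneg _).trans (hM p (Metric.mem_closedBall_self hε.le))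

/-- The leading term is harmonic in `G` near p, so there only the remainder contributes: O(r^(μ-1)),
with exponent above -1 because μ > 0. -/
theorem inL2_laplacian_singularSolution {G : Set Plane} (hG : IsOpen G)
    (hb : Bornology.IsBounded G) (hp : p ∉ G) {δ : ℝ} (hδ : 0 < δ)
    (hflat : ∀ y, ‖y - p‖ < δ → y ∈ G → 0 < (L (y - p)).re) (hμ : 0 < μ) (hC : ContDiff ℝ ∞ C)
    (hD : ContDiff ℝ ∞ D) (hD0 : D p = 0) :
    InL2 G (Laplacian.laplacian (singularSolution L p ε μ C D)) := by
  have hR := hasOrder_remainderTerm L p ε μ hC hD hD0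
  have hF := hasOrder_leadingTerm L p μ C
  have hu := hasOrder_singularSolution L p ε μ hC hD hD0
  obtain ⟨K, hK, hKb⟩ := abs_laplacian_le_of_hasOrder hR
  refine inL2_of_le_rpow hG hb hp (continuousOn_laplacian isOpen_compl_singleton hu.1)
    (ν := μ + 1 - 2) (by linarith) (δ := min δ 1) (K := K) (by positivity) fun y hy hyδ => ?_
  have hyp : y ≠ p := fun e => hp (e ▸ hy)
  have h0 : Laplacian.laplacian (fun y => leadingTerm L p μ C (y - p)) y = 0 := by
    have e : Laplacian.laplacian (fun y => leadingTerm L p μ C (y - p)) y =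
        Laplacian.laplacian (leadingTerm L p μ C) (y - p) := by
      simp only [InnerProductSpace.laplacian_eq_iteratedFDeriv_stdOrthonormalBasis,
        iteratedFDeriv_comp_sub]
    rw [e, leadingTerm, laplacian_comp_linearIsometryEquiv]
    exact laplacian_sectorial _ _ (hflat y (hyδ.trans_le (min_le_left _ _)) hy)
  have h1 : Laplacian.laplacian (singularSolution L p ε μ C D) y =
      Laplacian.laplacian (remainderTerm L p ε μ C D) y := by
    have := ((hF.contDiffAt hyp).of_le (natCast_le_infty 2)).laplacian_add
      ((hR.contDiffAt hyp).of_le (natCast_le_infty 2))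
    rw [h0, zero_add] at this
    exact this
  rw [h1]
  exact hKb y hyp (hyδ.le.trans (min_le_right _ _))

/-- Along the inner normal n the leading term has F(n) = 1, and its second radial derivative μ(μ -
1) is nonzero because 0 < μ < 1. -/
theorem not_inSobolev_two_singularSolution {G : Set Plane} (hG : IsOpen G) (hp : p ∉ G) {δ : ℝ}
    (hδ : 0 < δ) (hflat : ∀ y, ‖y - p‖ < δ → 0 < (L (y - p)).re → y ∈ G) (hμ : 0 < μ)
    (hμ1 : μ < 1) (hC : ContDiff ℝ ∞ C) (hD : ContDiff ℝ ∞ D) (hD0 : D p = 0) :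
    ¬ InSobolev G 2 (singularSolution L p ε μ C D) := by
  set n : Plane := L.symm 1 with hn
  have hLn : L n = 1 := L.apply_symm_apply 1
  have hn1 : ‖n‖ = 1 := by rw [← L.norm_map, hLn, norm_one]
  have hn0 : n ≠ 0 := by rintro h; simp [h] at hn1
  refine not_inSobolev_two_of_homogeneous hG hp hμ1 (contDiffOn_leadingTerm L p μ C)
    (leadingTerm_smul L p μ C) (hasOrder_remainderTerm L p ε μ hC hD hD0) hn1 ?_
    -- The disc of radius t about p + tn lies in the open half-plane, and within distance 2t < δ of
    -- p.
    (κ := 1) (δ := δ / 2) one_pos (by positivity) ?_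
  · rw [iteratedFDeriv_two_of_homogeneous (contDiffOn_leadingTerm L p μ C)
      (leadingTerm_smul L p μ C) hn0]
    have : leadingTerm L p μ C n = 1 := by
      have := sectorial_ofReal ⟨1, -C p⟩ μ zero_le_one
      rw [leadingTerm, Function.comp_apply, hLn]
      simpa using this
    rw [this, mul_one]
    exact mul_ne_zero hμ.ne' (by linarith)
  · intro t ht htδ y hy
    rw [Metric.mem_ball, dist_eq_norm, one_mul, ← sub_sub] at hy
    refine hflat y ?_ ?_
    · have : ‖y - p‖ ≤ ‖y - p - t • n‖ + ‖t • n‖ := by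
        simpa using norm_add_le (y - p - t • n) (t • n)
      rw [norm_smul, hn1, mul_one, Real.norm_of_nonneg ht.le] at this
      linarith
    · have h1 : |(L (y - p - t • n)).re| ≤ ‖y - p - t • n‖ := by
        rw [← L.norm_map]; exact Complex.abs_re_le_norm _
      rw [map_sub, map_smul, hLn] at h1
      have h2 := (abs_lt.1 (h1.trans_lt hy)).1
      simp only [Complex.sub_re, Complex.smul_re, Complex.one_re, smul_eq_mul, mul_one] at h2
      linarith

end SingularSolution

/-! ### Verification of the nonlocal conditions -/

/-- The singular solution about one of the two end points. -/
theorem exists_singular_solution_at {G : Set Plane} {p q : Plane} {γ₁ γ₂ : ℝ → Plane}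
    {Ω₁ Ω₂ Ω : Plane → Plane} {b₁ b₂ : Plane → ℝ} (hG : IsOpen G) (hbd : Bornology.IsBounded G)
    (hpq : p ≠ q) (hfr : frontier G = openCurve γ₁ ∪ openCurve γ₂ ∪ {p, q})
    (hflat : IsFlatNear G p) (hγ₁ : Continuous γ₁) (hγ₂ : Continuous γ₂)
    (hp₁ : p ∈ closure (openCurve γ₁)) (hp₂ : p ∈ closure (openCurve γ₂))
    (d₁ : IsDiffeoNear Ω₁ (closure (openCurve γ₁))) (d₂ : IsDiffeoNear Ω₂ (closure (openCurve γ₂)))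
    (d : IsDiffeoNear Ω (closure (openCurve γ₁)))
    (m₁ : MapsTo Ω₁ (openCurve γ₁) G) (m₂ : MapsTo Ω₂ (openCurve γ₂) G)
    (r₁ : RotatesNear Ω₁ (openCurve γ₁) p) (r₂ : RotatesNear Ω₂ (openCurve γ₂) p)
    (haway : p ∉ closure (Ω '' openCurve γ₁)) (hb₁ : ContDiff ℝ ∞ b₁) (hb₂ : ContDiff ℝ ∞ b₂)
    (hb : b₁ p + b₂ p ∈ Ioo (-2 : ℝ) 0) :
    ∃ f₀ : Plane → ℝ, InL2 G f₀ ∧ ∀ a : Plane → ℝ, ContDiff ℝ ∞ a → ∃ u : Plane → ℝ,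
      IsGeneralizedSolution G γ₁ γ₂ Ω₁ Ω₂ Ω b₁ b₂ a f₀ (fun _ => 0) (fun _ => 0) u ∧
      ¬ InSobolev G 2 u := by
  have hp : p ∉ G := by
    have : p ∈ frontier G := by rw [hfr]; right; left; rfl
    rw [hG.frontier_eq] at this
    exact this.2
  obtain ⟨L, δ, hδ, hLG, hL₁, hL₂⟩ := exists_local_coordinates hG hpq hfr hflat m₁ m₂ r₁ r₂
  obtain ⟨ε₁, hε₁, hε₁b⟩ := d₁.exists_le_norm_sub hγ₁ hp₁ r₁.1 hδ
  obtain ⟨ε₂, hε₂, hε₂b⟩ := d₂.exists_le_norm_sub hγ₂ hp₂ r₂.1 hδ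
  obtain ⟨ε₃, hε₃, hε₃b⟩ := exists_le_norm_sub_of_notMem_closure haway
  -- With this radius, u vanishes on Ω(Γ₁), and also at y and Ω_i(y) for every y on Γ_i with ‖y - p‖
  -- ≥ δ, where the local coordinates no longer apply.
  obtain ⟨ε, hε, hεδ, hε1, hε2, hε3⟩ : ∃ ε, 0 < ε ∧ ε ≤ δ ∧ ε ≤ ε₁ ∧ ε ≤ ε₂ ∧ ε ≤ ε₃ :=
    ⟨min (min δ ε₁) (min ε₂ ε₃), by positivity, by simp, by simp, by simp, by simp⟩
  obtain ⟨μ, hμ, hμ1, hcos, hsin⟩ := exists_exponent hb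
  set c := Real.cos (Real.pi / 2 * μ) with hc
  set s := Real.sin (Real.pi / 2 * μ) with hs
  -- C and D solve c + C s + D = -b₁ and c - C s + D = -b₂ at every point y; the choice of μ is what
  -- makes D vanish at p.
  let C : Plane → ℝ := fun y => (b₂ y - b₁ y) / (2 * s)
  let D : Plane → ℝ := fun y => -c - (b₁ y + b₂ y) / 2
  have hC : ContDiff ℝ ∞ C := (hb₂.sub hb₁).div_const _
  have hD : ContDiff ℝ ∞ D := contDiff_const.sub ((hb₁.add hb₂).div_const _)
  have hD0 : D p = 0 := by simp only [D]; linarith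
  have hCs : ∀ y, C y * s = (b₂ y - b₁ y) / 2 := fun y => by simp only [C]; field_simp
  set u := singularSolution L p ε μ C D with hu
  have hord : HasOrder p μ u := hasOrder_singularSolution L p ε μ hC hD hD0
  have hup : u p = 0 := singularSolution_self L hμ
  obtain ⟨M, hM⟩ := exists_norm_singularSolution_le L (p := p) hε hμ hC hD hD0
  have trace : ∀ {c : ℝ → Plane}, ContinuousOn c (Ioo 0 1) → HasTraceAlong G u c (u ∘ c) :=
    fun hc => hord.hasTraceAlong hG hbd hp hμ hup hM hc
  have cond₁ : ∀ y ∈ openCurve γ₁, u y + b₁ y * u (Ω₁ y) = 0 := by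
    intro y hy
    rcases le_or_gt δ ‖y - p‖ with hyδ | hyδ
    · rw [hu, singularSolution_of_ge L hε (hεδ.trans hyδ),
        singularSolution_of_ge L hε (hε1.trans (hε₁b y hy hyδ))]
      ring
    obtain ⟨e₁, e₂⟩ := hL₁ y hy hyδ
    have hn : ‖Ω₁ y - p‖ = ‖y - p‖ := by rw [← L.norm_map, e₂]; simp
    -- The formulas on the imaginary axis need y ≠ p; at y = p both values of u are zero.
    rcases (norm_nonneg (y - p)).eq_or_lt with h0 | h0
    · rw [← h0] at hn
      rw [sub_eq_zero.1 (norm_eq_zero.1 h0.symm)] at hn ⊢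
      rw [sub_eq_zero.1 (norm_eq_zero.1 hn), hup]; ring
    rw [hu, singularSolution_of_eq_norm_mul_I L h0 e₁, ← hc, ← hs, hCs,
      singularSolution_of_eq_norm L (by rw [hn, e₂]), hn, radialCutoff_congr ε hn]
    simp only [D]
    ring
  have cond₂ : ∀ y ∈ openCurve γ₂, u y + b₂ y * u (Ω₂ y) = 0 := by
    intro y hy
    rcases le_or_gt δ ‖y - p‖ with hyδ | hyδ
    · rw [hu, singularSolution_of_ge L hε (hεδ.trans hyδ),
        singularSolution_of_ge L hε (hε2.trans (hε₂b y hy hyδ))]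
      ring
    obtain ⟨e₁, e₂⟩ := hL₂ y hy hyδ
    have hn : ‖Ω₂ y - p‖ = ‖y - p‖ := by rw [← L.norm_map, e₂]; simp
    rcases (norm_nonneg (y - p)).eq_or_lt with h0 | h0
    · rw [← h0] at hn
      rw [sub_eq_zero.1 (norm_eq_zero.1 h0.symm)] at hn ⊢
      rw [sub_eq_zero.1 (norm_eq_zero.1 hn), hup]; ring
    rw [hu, singularSolution_of_eq_neg_norm_mul_I L h0 e₁, ← hc, ← hs, hCs,
      singularSolution_of_eq_norm L (by rw [hn, e₂]), hn, radialCutoff_congr ε hn]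
    simp only [D]
    ring
  -- Neither u nor its Laplacian involves a, so f₀ is fixed before a is given.
  refine ⟨Laplacian.laplacian u, inL2_laplacian_singularSolution L hG hbd hp hδ
    (fun y hy => (hLG y hy).1) hμ hC hD hD0, fun a _ => ⟨u, ⟨?_, ?_, ?_, ?_⟩, ?_⟩⟩
  · exact hord.inSobolev_one hG hbd hp hμ
  · exact weakPoisson_of_contDiffOn hG (contDiffOn_of_notMem hord.1 hp)
  · refine ⟨_, _, _, trace hγ₁.continuousOn, trace (d₁.continuousOn_comp hγ₁),
      trace (d.continuousOn_comp hγ₁), (ae_restrict_iff' measurableSet_Ioo).2 (.of_forall ?_)⟩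
    intro t ht
    have hy : γ₁ t ∈ openCurve γ₁ := mem_image_of_mem γ₁ ht
    have h0 : u (Ω (γ₁ t)) = 0 :=
      singularSolution_of_ge L hε (hε3.trans (hε₃b _ hy))
    simp only [Function.comp_apply]
    rw [h0, cond₁ _ hy]
    ring
  · refine ⟨_, _, trace hγ₂.continuousOn, trace (d₂.continuousOn_comp hγ₂),
      (ae_restrict_iff' measurableSet_Ioo).2 (.of_forall ?_)⟩
    intro t ht
    exact cond₂ _ (mem_image_of_mem γ₂ ht)
  · exact not_inSobolev_two_singularSolution L hG hp hδ (fun y hy => (hLG y hy).2) hμ hμ1 hC hD hD0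

end NonlocalProblem

theorem mainTheorem12 (G : Set Plane) (g h : Plane) (γ₁ γ₂ : ℝ → Plane)
    (hG : NonlocalProblem.IsDomain G g h γ₁ γ₂)
    (Ω₁ Ω₂ Ω : Plane → Plane)
    (hΩ₁ : NonlocalProblem.IsNearTransformation G g h γ₁ Ω₁)
    (hΩ₂ : NonlocalProblem.IsNearTransformation G g h γ₂ Ω₂)
    (hΩ : NonlocalProblem.IsFarTransformation G g h γ₁ Ω)
    (b₁ b₂ : Plane → ℝ) (hb₁ : ContDiff ℝ ∞ b₁) (hb₂ : ContDiff ℝ ∞ b₂)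
    (hb : b₁ g + b₂ g ∈ Ioo (-2 : ℝ) 0 ∨ b₁ h + b₂ h ∈ Ioo (-2 : ℝ) 0) :
    ∃ f₀ : Plane → ℝ, NonlocalProblem.InL2 G f₀ ∧
      ∀ a : Plane → ℝ, ContDiff ℝ ∞ a →
        ∃ u : Plane → ℝ,
          NonlocalProblem.IsGeneralizedSolution G γ₁ γ₂ Ω₁ Ω₂ Ω b₁ b₂ a f₀
            (fun _ => 0) (fun _ => 0) u ∧
          ¬ NonlocalProblem.InSobolev G 2 u := by
  have c₁ : Continuous γ₁ := hG.arc₁.smooth.continuous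
  have c₂ : Continuous γ₂ := hG.arc₂.smooth.continuous
  have m₀ : (0 : ℝ) ∈ Icc (0 : ℝ) 1 := left_mem_Icc.2 zero_le_one
  have m₁ : (1 : ℝ) ∈ Icc (0 : ℝ) 1 := right_mem_Icc.2 zero_le_one
  have hgh : g ≠ h := fun e => zero_ne_one (hG.arc₁.injOn m₀ m₁
    (by rw [hG.arc₁.start, hG.arc₁.finish, e]))
  have haway : ∀ p ∈ ({g, h} : Set Plane), p ∉ closure (Ω '' NonlocalProblem.openCurve γ₁) :=
    fun p hp hc => eq_empty_iff_forall_notMem.1 hΩ.away p ⟨hc, hp⟩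
  rcases hb with hb | hb
  · exact NonlocalProblem.exists_singular_solution_at hG.isOpen hG.bounded hgh hG.frontier_eq
      hG.flat_g c₁ c₂ (hG.arc₁.start ▸ NonlocalProblem.mem_closure_openCurve c₁ m₀)
      (hG.arc₂.start ▸ NonlocalProblem.mem_closure_openCurve c₂ m₀) hΩ₁.diffeo hΩ₂.diffeo hΩ.diffeo
      hΩ₁.mapsTo hΩ₂.mapsTo hΩ₁.rotates_g hΩ₂.rotates_g (haway g (by simp)) hb₁ hb₂ hb
  · exact NonlocalProblem.exists_singular_solution_at hG.isOpen hG.bounded hgh.symm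
      (by rw [hG.frontier_eq, pair_comm])
      hG.flat_h c₁ c₂ (hG.arc₁.finish ▸ NonlocalProblem.mem_closure_openCurve c₁ m₁)
      (hG.arc₂.finish ▸ NonlocalProblem.mem_closure_openCurve c₂ m₁) hΩ₁.diffeo hΩ₂.diffeo
      hΩ.diffeo hΩ₁.mapsTo hΩ₂.mapsTo hΩ₁.rotates_h hΩ₂.rotates_h (haway h (by simp)) hb₁ hb₂ hb
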